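/- Let $n\ge 0$, let $H$ be a Hermitian complex $n\times n$ matrix all of whose eigenvalues are nonzero, and let $\beta$ be a nonzero real number. Let $a_1,\dots,a_n$ and their adjoints $a_1^\dagger,\dots,a_n^\dagger$ be the fermionic annihilation and creation operators on the $2^n$-dimensional Fock space of $n$ lattice sites. Put $\hat H=\sum_{i,j}a_i^\dagger H_{ij}a_j$, $Z=\operatorname{Tr}e^{-\beta\hat H}$ and $\langle X\rangle=\operatorname{Tr}[X e^{-\beta\hat H}]/Z$ for every operator $X$ on the Fock space. Put $h_T=\coth(\tfrac{\beta}{2}H)$ (functional calculus of Hermitian matrices). Let $\theta_1,\dots,\theta_n,\bar\theta_1,\dots,\bar\theta_n$ be generators of a complex Grassmann algebra, and let $\int\big(\prod_{j=1}^n d\theta_j\,d\bar\theta_j\big)$ be the Berezin integral, i.e. the iterated integral in which integration over one generator is the left derivative with respect to it and the rightmost integration is performed first. Write $\bar\theta^{\top}h_T\theta=\sum_{j,l}(h_T)_{jl}\bar\theta_j\theta_l$. Then: 1. (Grassmann mapping.) There is exactly one linear map $X\mapsto\tilde X$ from the operators on the Fock space to the Grassmann algebra that sends every (possibly empty) product,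 in any order, of factors $a_j$, $a_j^\dagger$ or $a_j^\dagger a_j$ on pairwise distinct sites $j$ to the product, in the same order, obtained by the substitutions $$a_j\mapsto\frac{\theta_j}{\sqrt2},\qquad a_j^\dagger\mapsto\frac{\bar\theta_j}{\sqrt2},\qquad a_j^\dagger a_j\mapsto\frac{\bar\theta_j\theta_j+1}{2}.$$ 2. (Thermal averages.) $Z\neq0$, and for every operator $X$ on the Fock space $$\langle X\rangle=N\int\Big(\prod_{j=1}^n d\theta_j\,d\bar\theta_j\Big)\,\tilde X\,e^{-\bar\theta^{\top}h_T\theta},$$ where the normalization, which does not depend on $X$, is $$N^{-1}=\int\Big(\prod_{j=1}^n d\theta_j\,d\bar\theta_j\Big)\,e^{-\bar\theta^{\top}h_T\theta}=\det(-h_T)\neq0.$$ 3. (Two-point functions.) For all $j,l$, $$\langle a_j^\dagger a_l\rangle=\tfrac12\big(\delta_{jl}-(h_T^{-1})_{lj}\big),\qquad N\int\Big(\prod_{i=1}^n d\theta_i\,d\bar\theta_i\Big)\,\bar\theta_j\theta_l\,e^{-\bar\theta^{\top}h_T\theta}=-(h_T^{-1})_{lj}.$$ -/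

import Mathlib

noncomputable section

namespace FreeFermion

open Matrix

/-! ### Fock space of `n` fermionic lattice sites -/

/-- Operators on the `2 ^ n`-dimensional Fock space, as matrices in the occupation number basis:
the basis vector `S : Finset (Fin n)` is the state in which exactly the sites in `S` are
occupied. -/
abbrev FockOp (n : ℕ) : Type := Matrix (Finset (Fin n)) (Finset (Fin n)) ℂ

/-- The annihilation operator `a_j`. It sends the basis vector `S` to
`(-1) ^ #{i ∈ S | i < j}` times the basis vector `S \ {j}` if `j ∈ S`, and to `0` otherwise. -/
def ann {n : ℕ} (j : Fin n) : FockOp n :=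
  Matrix.of fun T S =>
    if j ∈ S ∧ T = S.erase j then (-1 : ℂ) ^ (S.filter (fun i => i < j)).card else 0

/-- The creation operator `a_j†`, the adjoint of `a_j`. -/
def cre {n : ℕ} (j : Fin n) : FockOp n := (ann j)ᴴ

/-- The many-body Hamiltonian `Ĥ = ∑ i j, a_i† H_ij a_j`. -/
def hamiltonian {n : ℕ} (H : Matrix (Fin n) (Fin n) ℂ) : FockOp n :=
  ∑ i, ∑ j, H i j • (cre i * ann j)

/-- The unnormalized density matrix `exp (-β Ĥ)`. -/
def boltzmann {n : ℕ} (β : ℝ) (H : Matrix (Fin n) (Fin n) ℂ) : FockOp n :=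
  NormedSpace.exp (-((β : ℂ) • hamiltonian H))

/-- The partition function `Z = Tr exp (-β Ĥ)`. -/
def partitionFunction {n : ℕ} (β : ℝ) (H : Matrix (Fin n) (Fin n) ℂ) : ℂ :=
  (boltzmann β H).trace

/-- The thermal average `⟨X⟩ = Tr (X exp (-β Ĥ)) / Z`. -/
def thermalAverage {n : ℕ} (β : ℝ) (H : Matrix (Fin n) (Fin n) ℂ) (X : FockOp n) : ℂ :=
  (X * boltzmann β H).trace / partitionFunction β H

/-- The link matrix `h_T = coth ((β / 2) H)`, through the functional calculus of
Hermitian matrices. -/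
def linkMatrix {n : ℕ} (β : ℝ) (H : Matrix (Fin n) (Fin n) ℂ) : Matrix (Fin n) (Fin n) ℂ :=
  cfc (fun x : ℝ => Real.cosh x / Real.sinh x) ((β / 2) • H)

/-! ### Grassmann variables and the Berezin integral -/

/-- The complex Grassmann algebra on the `2 * n` generators `θ_j`, `θ̄_j`. -/
abbrev Grassmann (n : ℕ) : Type := ExteriorAlgebra ℂ (Fin n ⊕ Fin n → ℂ)

/-- The generator `θ_j`. -/
def theta {n : ℕ} (j : Fin n) : Grassmann n := ExteriorAlgebra.ι ℂ (Pi.single (Sum.inl j) 1)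

/-- The generator `θ̄_j`. -/
def thetaBar {n : ℕ} (j : Fin n) : Grassmann n := ExteriorAlgebra.ι ℂ (Pi.single (Sum.inr j) 1)

/-- Integration `∫ dη_v` over the single generator `η_v` (`η_v = θ_j` for `v = inl j` and
`η_v = θ̄_j` for `v = inr j`). By Berezin's rules this is the left derivative: the
antiderivation which sends `η_v` to `1` and all other generators to `0`. -/
def intVar {n : ℕ} (v : Fin n ⊕ Fin n) : Grassmann n →ₗ[ℂ] Grassmann n :=
  CliffordAlgebra.contractLeft (LinearMap.proj v : (Fin n ⊕ Fin n → ℂ) →ₗ[ℂ] ℂ)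

/-- The Berezin integral `∫ (∏ j, dθ_j dθ̄_j) f`, an iterated integral whose innermost
integration is the rightmost one: `∫ dθ dθ̄ (θ̄ θ) = 1` for `n = 1`. After all generators have
been integrated out, only a scalar is left, which is read off by `algebraMapInv`. -/
def berezin {n : ℕ} (f : Grassmann n) : ℂ :=
  ExteriorAlgebra.algebraMapInv
    ((List.ofFn fun j : Fin n =>
      (intVar (Sum.inl j) ∘ₗ intVar (Sum.inr j) : Module.End ℂ (Grassmann n))).prod f)

/-- The Gaussian weight `exp (-θ̄ᵀ h θ) = exp (-∑ j l, h_jl θ̄_j θ_l)`; the exponent is nilpotent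
and the exponential series is a finite sum. -/
def gaussWeight {n : ℕ} (h : Matrix (Fin n) (Fin n) ℂ) : Grassmann n :=
  IsNilpotent.exp (-∑ j, ∑ l, h j l • (thetaBar j * theta l))

/-! ### The Grassmann mapping -/

/-- The nontrivial factors with which an operator can act on one site:
`a_j`, `a_j†` and `a_j† a_j`. -/
inductive SiteFactor : Type
  | a
  | adag
  | adagA

/-- The operator on Fock space denoted by a factor on site `j`. -/
def SiteFactor.toOp {n : ℕ} (j : Fin n) : SiteFactor → FockOp n
  | .a => ann j
  | .adag => cre j
  | .adagA => cre j * ann j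

/-- The Grassmann substitute for a factor on site `j`: `a_j ↦ θ_j / √2`, `a_j† ↦ θ̄_j / √2`
and `a_j† a_j ↦ (θ̄_j θ_j + 1) / 2`. -/
def SiteFactor.toGrassmann {n : ℕ} (j : Fin n) : SiteFactor → Grassmann n
  | .a => ((1 / Real.sqrt 2 : ℝ) : ℂ) • theta j
  | .adag => ((1 / Real.sqrt 2 : ℝ) : ℂ) • thetaBar j
  | .adagA => (1 / 2 : ℂ) • (thetaBar j * theta j + 1)

/-- `Φ : X ↦ X̃` is a Grassmann mapping if it is linear and turns every (possibly empty) product,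
in any order, of factors on pairwise distinct sites into the product, in the same order, of the
substitutes of these factors. -/
def IsGrassmannMapping {n : ℕ} (Φ : FockOp n →ₗ[ℂ] Grassmann n) : Prop :=
  ∀ m : List (Fin n × SiteFactor), (m.map Prod.fst).Nodup →
    Φ (m.map fun p => p.2.toOp p.1).prod = (m.map fun p => p.2.toGrassmann p.1).prod

end FreeFermion

end

noncomputable section

namespace FreeFermion

open Matrix

/-! ### Operators on Fock space -/

section Fock

variable {n : ℕ}

/-! The Grassmann mapping is a symbol map. The operators `ann j`, `cre j` satisfy the canonical
anticommutation relations, so Fock space carries a representation of the Clifford algebra of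
`modeForm`. It is onto because words in distinct sites span all matrices (`wordSpan_univ`), hence
bijective by dimension (`fockRep_bijective`). The same Clifford algebra acts on the Grassmann
algebra, a generator `x` acting as `(x + ∂_x) / √2`. The symbol of an operator is the result of its
action on `1`. In a word with distinct sites the contraction terms vanish except for the constant in
`a_j† a_j`, which gives the substitution rules; spanning gives uniqueness.

For thermal averages, the trace against the Boltzmann operator and the Gaussian average of symbols
obey the same exchange rule. If `A` is an annihilation or creation operator of an eigenmode of `H`,
then `f (A X) = lam * f (X A)`. On the thermal side `lam` comes from `[Ĥ, A] = ∓ε A`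
(`boltzmann_mul`). On the Gaussian side integration by parts (`gaussAverage_contr`) replaces `∂_A`
by `±κ A`, so `lam` is `(κ + 1) / (κ - 1)` or its inverse (`gaussAverage_symbol_kms`). With `κ =
coth (β ε / 2)` both factors are `exp (± β ε)`. Writing the Gaussian functional as `Tr (X D)`, the
operator `ρ⁻¹ D` then commutes with every `a_j` and `a_j†`, so it is a scalar.

The Gaussian integral is a determinant because it is an alternating form in the rows of the matrix
(`berezin_gaussWeight`). It is nonzero, which makes the proportionality constant and `Z` nonzero.
Integration by parts against a single `θ_l` gives the two-point function. -/

/-- The sign `(-1) ^ #{i ∈ S | i < j}`. -/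
def parity (j : Fin n) (S : Finset (Fin n)) : ℂ :=
  (-1) ^ (S.filter (fun i => i < j)).card

lemma parity_mul_self (j : Fin n) (S : Finset (Fin n)) : parity j S * parity j S = 1 := by
  rw [parity, ← mul_pow]; simp

lemma parity_ne_zero (j : Fin n) (S : Finset (Fin n)) : parity j S ≠ 0 := by
  intro h; simpa [h] using parity_mul_self j S

lemma parity_insert_of_le {i j : Fin n} (h : j ≤ i) (S : Finset (Fin n)) :
    parity j (insert i S) = parity j S := by
  rw [parity, parity, Finset.filter_insert, if_neg (not_lt.2 h)]

lemma parity_insert_of_lt {i j : Fin n} (h : i < j) {S : Finset (Fin n)} (hi : i ∉ S) :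
    parity j (insert i S) = -parity j S := by
  rw [parity, parity, Finset.filter_insert, if_pos h, Finset.card_insert_of_notMem (by simp [hi]),
    pow_succ]
  ring

lemma parity_erase_of_le {i j : Fin n} (h : j ≤ i) (S : Finset (Fin n)) :
    parity j (S.erase i) = parity j S := by
  by_cases hi : i ∈ S
  · rw [← parity_insert_of_le h (S.erase i), Finset.insert_erase hi]
  · rw [Finset.erase_eq_of_notMem hi]

lemma parity_erase_of_lt {i j : Fin n} (h : i < j) {S : Finset (Fin n)} (hi : i ∈ S) :
    parity j (S.erase i) = -parity j S := by
  conv_rhs => rw [← Finset.insert_erase hi, parity_insert_of_lt h (Finset.notMem_erase _ _)]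
  simp

/-! ### Matrix entries of products and the canonical anticommutation relations. -/

lemma ann_mul_apply (j : Fin n) (X : FockOp n) (T R : Finset (Fin n)) :
    (ann j * X) T R = if j ∈ T then 0 else parity j T * X (insert j T) R := by
  rw [Matrix.mul_apply]
  split_ifs with hj
  · refine Finset.sum_eq_zero fun S _ => ?_
    rw [ann, Matrix.of_apply, if_neg, zero_mul]
    rintro ⟨-, rfl⟩
    exact Finset.notMem_erase _ _ hj
  · rw [Finset.sum_eq_single (insert j T)]
    · rw [ann, Matrix.of_apply, if_pos ⟨Finset.mem_insert_self _ _,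
        (Finset.erase_insert hj).symm⟩, ← parity_insert_of_le le_rfl T, parity]
    · intro S _ hS
      rw [ann, Matrix.of_apply, if_neg, zero_mul]
      rintro ⟨h, rfl⟩
      exact hS (Finset.insert_erase h).symm
    · simp

lemma cre_mul_apply (j : Fin n) (X : FockOp n) (T R : Finset (Fin n)) :
    (cre j * X) T R = if j ∈ T then parity j T * X (T.erase j) R else 0 := by
  rw [Matrix.mul_apply]
  split_ifs with hj
  · rw [Finset.sum_eq_single (T.erase j)]
    · simp [cre, ann, hj, parity]
    · intro S _ hS
      simp [cre, ann, hS]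
    · simp
  · refine Finset.sum_eq_zero fun S _ => ?_
    simp [cre, ann, hj]

lemma cre_mul_ann_mul_apply (j : Fin n) (X : FockOp n) (T R : Finset (Fin n)) :
    (cre j * ann j * X) T R = if j ∈ T then X T R else 0 := by
  rw [mul_assoc, cre_mul_apply]
  split_ifs with hj
  · rw [ann_mul_apply, if_neg (Finset.notMem_erase _ _), parity_erase_of_le le_rfl,
      Finset.insert_erase hj, ← mul_assoc, parity_mul_self, one_mul]
  · rfl

lemma ann_mul_ann_add_of_lt {i j : Fin n} (h : i < j) : ann i * ann j + ann j * ann i = 0 := by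
  ext T R
  -- A trailing factor `1` lets the entry formulas for left multiplication apply to both factors.
  rw [← mul_one (ann j), mul_assoc (ann j), one_mul, ← mul_one (ann i), mul_assoc (ann i), one_mul,
    Matrix.add_apply, ann_mul_apply, ann_mul_apply, ann_mul_apply, ann_mul_apply]
  by_cases hi : i ∈ T <;> by_cases hj : j ∈ T <;> simp [hi, hj, h.ne, h.ne']
  rw [parity_insert_of_lt h hi, parity_insert_of_le h.le, Finset.insert_comm]
  ring

lemma ann_mul_self (j : Fin n) : ann j * ann j = 0 := by
  ext T R
  rw [ann_mul_apply]
  split_ifs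
  · rfl
  · rw [← mul_one (ann j), ann_mul_apply, if_pos (Finset.mem_insert_self _ _), mul_zero]; rfl

lemma ann_mul_ann_add (i j : Fin n) : ann i * ann j + ann j * ann i = 0 := by
  rcases lt_trichotomy i j with h | rfl | h
  · exact ann_mul_ann_add_of_lt h
  · rw [ann_mul_self, add_zero]
  · rw [add_comm, ann_mul_ann_add_of_lt h]

lemma cre_mul_cre_add (i j : Fin n) : cre i * cre j + cre j * cre i = 0 := by
  have := congrArg conjTranspose (ann_mul_ann_add j i)
  simpa [cre] using this

lemma ann_mul_cre_add (i j : Fin n) :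
    ann i * cre j + cre j * ann i = if i = j then 1 else 0 := by
  ext T R
  rw [← mul_one (cre j), mul_assoc (cre j), one_mul, ← mul_one (ann i), mul_assoc (ann i), one_mul,
    Matrix.add_apply, ann_mul_apply, cre_mul_apply, cre_mul_apply, ann_mul_apply]
  by_cases hij : i = j
  · subst hij
    by_cases hi : i ∈ T <;>
      simp [hi, parity_insert_of_le, parity_erase_of_le, ← mul_assoc, parity_mul_self]
    · rw [Finset.insert_erase hi]
    · rw [Finset.erase_insert hi]
  · by_cases hi : i ∈ T <;> by_cases hj : j ∈ T <;> simp [hi, hj, hij, Ne.symm hij]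
    rw [Finset.erase_insert_of_ne hij]
    -- Changing the occupation of the smaller site flips the sign at the larger one and not
    -- conversely, so exactly one of the two signs flips.
    rcases lt_or_gt_of_ne hij with h | h
    · rw [parity_insert_of_lt h hi, parity_erase_of_le h.le]; ring
    · rw [parity_insert_of_le h.le, parity_erase_of_lt h hj]; ring

/-! ### Products of factors on distinct sites span the operators -/

/-- The span of the products of factors on pairwise distinct sites in `L`. -/
def wordSpan (L : Finset (Fin n)) : Submodule ℂ (FockOp n) :=
  Submodule.span ℂ {X | ∃ m : List (Fin n × SiteFactor), (m.map Prod.fst).Nodup ∧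
    (∀ p ∈ m, p.1 ∈ L) ∧ X = (m.map fun p => p.2.toOp p.1).prod}

lemma wordSpan_mono {L M : Finset (Fin n)} (h : L ⊆ M) : wordSpan L ≤ wordSpan M :=
  Submodule.span_mono fun _ ⟨m, hm, hL, hX⟩ => ⟨m, hm, fun p hp => h (hL p hp), hX⟩

lemma toOp_mul_mem_wordSpan {L : Finset (Fin n)} {j : Fin n} (hj : j ∉ L) (s : SiteFactor)
    {X : FockOp n} (hX : X ∈ wordSpan L) : s.toOp j * X ∈ wordSpan (insert j L) := by
  refine Submodule.span_induction (p := fun X _ => s.toOp j * X ∈ wordSpan (insert j L))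
    ?_ ?_ ?_ ?_ hX
  · rintro _ ⟨m, hm, hL, rfl⟩
    refine Submodule.subset_span ⟨(j, s) :: m, ?_, ?_, ?_⟩
    · rw [List.map_cons, List.nodup_cons]
      refine ⟨fun h => ?_, hm⟩
      obtain ⟨p, hp, rfl⟩ := List.mem_map.1 h
      exact hj (hL p hp)
    · intro p hp
      rcases List.mem_cons.1 hp with rfl | hp
      · exact Finset.mem_insert_self _ _
      · exact Finset.mem_insert_of_mem (hL p hp)
    · rw [List.map_cons, List.prod_cons]
  · simp
  · intro x y _ _ hx hy
    rw [mul_add]; exact add_mem hx hy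
  · intro c x _ hx
    rw [mul_smul_comm]; exact Submodule.smul_mem _ _ hx

/-- On each site the four matrix units are `a† a`, `a†`, `a` and `1 - a† a`, chosen according to
membership in `S` (row) and `T` (column). Only the support is tracked, so the fermionic signs need
no bookkeeping; for `L = univ` a single entry survives. -/
lemma exists_mem_wordSpan_support (S T L : Finset (Fin n)) :
    ∃ X ∈ wordSpan L, ∀ R' R, X R' R ≠ 0 ↔
      (∀ i ∈ L, (i ∈ R' ↔ i ∈ S) ∧ (i ∈ R ↔ i ∈ T)) ∧ ∀ i ∉ L, (i ∈ R' ↔ i ∈ R) := by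
  induction L using Finset.induction_on with
  | empty =>
    refine ⟨1, Submodule.subset_span ⟨[], by simp, by simp, by simp⟩, fun R' R => ?_⟩
    simp [Matrix.one_apply, Finset.ext_iff]
  | insert j L hj ih =>
    obtain ⟨X, hX, h⟩ := ih
    by_cases hS : j ∈ S <;> by_cases hT : j ∈ T
    · refine ⟨_, toOp_mul_mem_wordSpan hj .adagA hX, fun R' R => ?_⟩
      rw [SiteFactor.toOp, cre_mul_ann_mul_apply, ne_eq, ite_eq_right_iff, Classical.not_imp,
        ← ne_eq, h]
      grind
    · refine ⟨_, toOp_mul_mem_wordSpan hj .adag hX, fun R' R => ?_⟩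
      rw [SiteFactor.toOp, cre_mul_apply, ne_eq, ite_eq_right_iff, Classical.not_imp,
        ← ne_eq, mul_ne_zero_iff, h]
      simp only [parity_ne_zero, ne_eq, not_false_eq_true, true_and]
      grind
    · refine ⟨_, toOp_mul_mem_wordSpan hj .a hX, fun R' R => ?_⟩
      rw [SiteFactor.toOp, ann_mul_apply, ne_eq, ite_eq_left_iff, Classical.not_imp,
        ← ne_eq, mul_ne_zero_iff, h]
      simp only [parity_ne_zero, ne_eq, not_false_eq_true, true_and]
      grind
    · refine ⟨_, sub_mem (wordSpan_mono (Finset.subset_insert j L) hX)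
        (toOp_mul_mem_wordSpan hj .adagA hX), fun R' R => ?_⟩
      rw [SiteFactor.toOp, Matrix.sub_apply, cre_mul_ann_mul_apply]
      have := h R' R
      by_cases hj' : j ∈ R' <;> simp only [hj', if_true, if_false, sub_self, sub_zero, this] <;>
        grind

theorem wordSpan_univ : wordSpan (Finset.univ : Finset (Fin n)) = ⊤ := by
  refine eq_top_iff.2 fun Y _ => ?_
  rw [Matrix.matrix_eq_sum_single Y]
  refine sum_mem fun S _ => sum_mem fun T _ => ?_
  obtain ⟨X, hX, h⟩ := exists_mem_wordSpan_support S T Finset.univ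
  have hST : X S T ≠ 0 := by rw [h]; simp
  have : Matrix.single S T (Y S T) = (Y S T / X S T) • X := by
    ext R' R
    rw [Matrix.single_apply, Matrix.smul_apply, smul_eq_mul]
    split_ifs with hR
    · rw [← hR.1, ← hR.2, div_mul_cancel₀ _ hST]
    · have : ¬ X R' R ≠ 0 := by
        rw [h]
        rintro ⟨h1, -⟩
        exact hR ⟨Finset.ext fun i => (h1 i (Finset.mem_univ i)).1.symm,
          Finset.ext fun i => (h1 i (Finset.mem_univ i)).2.symm⟩
      rw [not_not.1 this, mul_zero]
  rw [this]
  exact Submodule.smul_mem _ _ hX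

end Fock

/-! ### The Clifford algebra of the anticommutation relations -/

section Mapping

variable {n : ℕ}

/-- The symmetric pairing of the mode space in which `θ_j` is dual to `θ̄_j`. -/
def pairing (n : ℕ) : LinearMap.BilinForm ℂ (Fin n ⊕ Fin n → ℂ) :=
  ∑ v : Fin n ⊕ Fin n, (LinearMap.proj v : (Fin n ⊕ Fin n → ℂ) →ₗ[ℂ] ℂ).smulRight
    (LinearMap.proj v.swap : (Fin n ⊕ Fin n → ℂ) →ₗ[ℂ] ℂ)

lemma pairing_apply (x y : Fin n ⊕ Fin n → ℂ) : pairing n x y = ∑ v, x v * y v.swap := by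
  simp [pairing, LinearMap.sum_apply]

lemma pairing_comm (x y : Fin n ⊕ Fin n → ℂ) : pairing n x y = pairing n y x := by
  rw [pairing_apply, pairing_apply, ← Equiv.sum_comp (Equiv.sumComm (Fin n) (Fin n))]
  simp [mul_comm]

/-- The quadratic form on the mode space encoding the canonical anticommutation relations. -/
def modeForm (n : ℕ) : QuadraticForm ℂ (Fin n ⊕ Fin n → ℂ) :=
  LinearMap.BilinMap.toQuadraticMap ((1 / 2 : ℂ) • pairing n)

lemma modeForm_apply (x : Fin n ⊕ Fin n → ℂ) : modeForm n x = 1 / 2 * pairing n x x := by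
  simp [modeForm]

/-- The field operator `∑ j, (x_j a_j + y_j a_j†)`. -/
def fieldOp (n : ℕ) : (Fin n ⊕ Fin n → ℂ) →ₗ[ℂ] FockOp n :=
  Fintype.linearCombination ℂ (Sum.elim ann cre)

lemma fieldOp_single_inl (j : Fin n) : fieldOp n (Pi.single (Sum.inl j) 1) = ann j := by
  simp [fieldOp, Fintype.linearCombination_apply_single]

lemma fieldOp_single_inr (j : Fin n) : fieldOp n (Pi.single (Sum.inr j) 1) = cre j := by
  simp [fieldOp, Fintype.linearCombination_apply_single]

lemma gen_anticomm (v w : Fin n ⊕ Fin n) :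
    (Sum.elim ann cre v * Sum.elim ann cre w + Sum.elim ann cre w * Sum.elim ann cre v : FockOp n) =
      if w = v.swap then 1 else 0 := by
  rcases v with i | i <;> rcases w with j | j
  · simpa using ann_mul_ann_add i j
  · simpa [eq_comm] using ann_mul_cre_add i j
  · simpa [add_comm] using ann_mul_cre_add j i
  · simpa using cre_mul_cre_add i j

lemma fieldOp_anticomm (x y : Fin n ⊕ Fin n → ℂ) :
    fieldOp n x * fieldOp n y + fieldOp n y * fieldOp n x = pairing n x y • (1 : FockOp n) := by
  simp only [fieldOp, Fintype.linearCombination_apply, Finset.sum_mul_sum]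
  rw [Finset.sum_comm (f := fun i j => y i • Sum.elim ann cre i * x j • Sum.elim ann cre j),
    ← Finset.sum_add_distrib, pairing_apply, Finset.sum_smul]
  refine Finset.sum_congr rfl fun v _ => ?_
  rw [← Finset.sum_add_distrib]
  have : ∀ w, (x v • Sum.elim ann cre v * y w • Sum.elim ann cre w +
      y w • Sum.elim ann cre w * x v • Sum.elim ann cre v : FockOp n) =
      if w = v.swap then (x v * y w) • 1 else 0 := by
    intro w
    rw [smul_mul_smul_comm, smul_mul_smul_comm, mul_comm (y w), ← smul_add, gen_anticomm]
    split_ifs <;> simp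
  simp only [this, Finset.sum_ite_eq', Finset.mem_univ, if_true]

lemma fieldOp_mul_self (x : Fin n ⊕ Fin n → ℂ) :
    fieldOp n x * fieldOp n x = algebraMap ℂ (FockOp n) (modeForm n x) := by
  have h := fieldOp_anticomm x x
  rw [← two_smul ℂ] at h
  rw [modeForm_apply, Algebra.algebraMap_eq_smul_one, mul_smul, ← h, smul_smul]
  norm_num

/-- The Fock representation of the Clifford algebra. -/
def fockRep (n : ℕ) : CliffordAlgebra (modeForm n) →ₐ[ℂ] FockOp n :=
  CliffordAlgebra.lift (modeForm n) ⟨fieldOp n, fieldOp_mul_self⟩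

lemma fockRep_ι (x : Fin n ⊕ Fin n → ℂ) :
    fockRep n (CliffordAlgebra.ι _ x) = fieldOp n x := CliffordAlgebra.lift_ι_apply _ _ _

lemma ann_mem_range (j : Fin n) : ann j ∈ (fockRep n).range :=
  ⟨CliffordAlgebra.ι _ (Pi.single (Sum.inl j) 1), by
    rw [← fieldOp_single_inl]; exact fockRep_ι _⟩

lemma cre_mem_range (j : Fin n) : cre j ∈ (fockRep n).range :=
  ⟨CliffordAlgebra.ι _ (Pi.single (Sum.inr j) 1), by
    rw [← fieldOp_single_inr]; exact fockRep_ι _⟩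

lemma fockRep_surjective : Function.Surjective (fockRep n) := by
  have h : wordSpan Finset.univ ≤ Subalgebra.toSubmodule (fockRep n).range := by
    refine Submodule.span_le.2 ?_
    rintro _ ⟨m, -, -, rfl⟩
    refine Subalgebra.list_prod_mem _ fun X hX => ?_
    obtain ⟨⟨j, s⟩, -, rfl⟩ := List.mem_map.1 hX
    cases s
    · exact ann_mem_range j
    · exact cre_mem_range j
    · exact mul_mem (cre_mem_range j) (ann_mem_range j)
  intro X
  exact h (wordSpan_univ.symm ▸ Submodule.mem_top : X ∈ wordSpan Finset.univ)

/-- A basis of the Grassmann algebra. -/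
def grassmannBasis (n : ℕ) : Module.Basis (Finset (Fin n ⊕ₗ Fin n)) ℂ (Grassmann n) :=
  Module.Basis.ExteriorAlgebra ((Pi.basisFun ℂ (Fin n ⊕ Fin n)).reindex toLex)

/-- A surjection between spaces of equal finite dimension: the Clifford algebra is linearly the
exterior algebra on `2 n` generators, and `2 ^ (2 n) = (2 ^ n) ^ 2`. -/
lemma fockRep_bijective : Function.Bijective (fockRep n) := by
  let e := (CliffordAlgebra.equivExterior (modeForm n)).trans (grassmannBasis n).equivFun
  have : FiniteDimensional ℂ (CliffordAlgebra (modeForm n)) := Module.Finite.equiv e.symm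
  refine ⟨(LinearMap.injective_iff_surjective_of_finrank_eq_finrank
    (f := (fockRep n).toLinearMap) ?_).2 fockRep_surjective, fockRep_surjective⟩
  rw [e.finrank_eq, Module.finrank_fintype_fun_eq_card, Module.finrank_matrix]
  simp [← two_mul, pow_mul', sq, show Fintype.card (Fin n ⊕ₗ Fin n) = n + n from by
    rw [Fintype.card_lex]; simp]

/-! ### The Grassmann mapping as a symbol map -/

/-- Contraction of the Grassmann algebra with a linear form. -/
abbrev contr (d : Module.Dual ℂ (Fin n ⊕ Fin n → ℂ)) : Module.End ℂ (Grassmann n) :=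
  CliffordAlgebra.contractLeft d

lemma contr_ι_mul (d : Module.Dual ℂ (Fin n ⊕ Fin n → ℂ)) (x : Fin n ⊕ Fin n → ℂ)
    (Y : Grassmann n) :
    contr d (ExteriorAlgebra.ι ℂ x * Y) = d x • Y - ExteriorAlgebra.ι ℂ x * contr d Y :=
  CliffordAlgebra.contractLeft_ι_mul _ _ _

lemma contr_contr_comm (d e : Module.Dual ℂ (Fin n ⊕ Fin n → ℂ)) (Y : Grassmann n) :
    contr d (contr e Y) = -contr e (contr d Y) :=
  CliffordAlgebra.contractLeft_comm _ _ _

lemma contr_involute (d : Module.Dual ℂ (Fin n ⊕ Fin n → ℂ)) (Y : Grassmann n) :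
    contr d (CliffordAlgebra.involute Y) = -CliffordAlgebra.involute (contr d Y) := by
  induction Y using CliffordAlgebra.left_induction with
  | algebraMap r => simp [contr]
  | add x y hx hy => rw [map_add, map_add, hx, hy, map_add, map_add]; abel
  | ι_mul Y x hY =>
    have h1 := contr_ι_mul d x (CliffordAlgebra.involute Y)
    have h2 := contr_ι_mul d x Y
    simp only [ExteriorAlgebra.ι] at h1 h2
    rw [map_mul, CliffordAlgebra.involute_ι, neg_mul, map_neg, h1, h2, hY, map_sub, map_smul,
      map_mul, CliffordAlgebra.involute_ι]
    simp [mul_neg, neg_mul]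

/-- The factor `1 / √2`. -/
def invSqrtTwo : ℂ := ((1 / Real.sqrt 2 : ℝ) : ℂ)

lemma invSqrtTwo_mul_self : invSqrtTwo * invSqrtTwo = 1 / 2 := by
  rw [invSqrtTwo, ← Complex.ofReal_mul, div_mul_div_comm, Real.mul_self_sqrt (by norm_num)]
  norm_num

/-- The action of a field operator on symbols from the left: `(x + ∂_x) / √2`. -/
def leftAct (n : ℕ) : (Fin n ⊕ Fin n → ℂ) →ₗ[ℂ] Module.End ℂ (Grassmann n) :=
  invSqrtTwo • (LinearMap.mul ℂ (Grassmann n) ∘ₗ ExteriorAlgebra.ι ℂ +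
    CliffordAlgebra.contractLeft ∘ₗ pairing n)

lemma leftAct_apply (x : Fin n ⊕ Fin n → ℂ) (Y : Grassmann n) :
    leftAct n x Y = invSqrtTwo • (ExteriorAlgebra.ι ℂ x * Y + contr (pairing n x) Y) := rfl

/-- The action of a field operator on symbols from the right. -/
def rightAct (x : Fin n ⊕ Fin n → ℂ) (Y : Grassmann n) : Grassmann n :=
  invSqrtTwo • (ExteriorAlgebra.ι ℂ x * CliffordAlgebra.involute Y -
    contr (pairing n x) (CliffordAlgebra.involute Y))

/-- Multiplication by `x` and contraction with `x` both square to zero, and their anticommutator is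
the scalar `pairing n x x`; the prefactor squared supplies the `1 / 2`. -/
lemma leftAct_mul_self (x : Fin n ⊕ Fin n → ℂ) :
    leftAct n x * leftAct n x = algebraMap ℂ _ (modeForm n x) := by
  refine LinearMap.ext fun Y => ?_
  rw [Module.End.mul_apply, leftAct_apply, leftAct_apply, map_smul, mul_smul_comm, ← smul_add,
    smul_smul, invSqrtTwo_mul_self, map_add, contr_ι_mul, mul_add, ← mul_assoc,
    ExteriorAlgebra.ι_sq_zero, zero_mul, modeForm_apply, Module.algebraMap_end_apply]
  have : contr (pairing n x) (contr (pairing n x) Y) = 0 :=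
    CliffordAlgebra.contractLeft_contractLeft _ _
  rw [this, mul_smul]
  congr 1
  abel

/-- This is associativity `A (X B) = (A X) B` at the level of symbols. The mixed terms cancel
because the pairing is symmetric. -/
lemma leftAct_rightAct (x y : Fin n ⊕ Fin n → ℂ) (Y : Grassmann n) :
    leftAct n x (rightAct y Y) = rightAct y (leftAct n x Y) := by
  simp only [rightAct, leftAct_apply, map_smul, map_add, map_sub, map_mul]
  have h : CliffordAlgebra.involute (ExteriorAlgebra.ι ℂ x) = -ExteriorAlgebra.ι ℂ x :=
    CliffordAlgebra.involute_ι _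
  have h' : CliffordAlgebra.involute (contr (pairing n x) Y) =
      -contr (pairing n x) (CliffordAlgebra.involute Y) := by rw [contr_involute, neg_neg]
  rw [h, h']
  simp only [mul_smul_comm, neg_mul, mul_neg, map_neg, mul_add, contr_ι_mul,
    pairing_comm y x, contr_contr_comm (pairing n y) (pairing n x), ← mul_assoc]
  have h'' : ExteriorAlgebra.ι ℂ x * ExteriorAlgebra.ι ℂ y =
      -(ExteriorAlgebra.ι ℂ y * ExteriorAlgebra.ι ℂ x) :=
    eq_neg_of_add_eq_zero_left (ExteriorAlgebra.ι_add_mul_swap x y)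
  rw [h'', neg_mul]
  congr 1
  module

/-- The representation of the Clifford algebra on symbols. -/
def symbolRep (n : ℕ) : CliffordAlgebra (modeForm n) →ₐ[ℂ] Module.End ℂ (Grassmann n) :=
  CliffordAlgebra.lift (modeForm n) ⟨leftAct n, leftAct_mul_self⟩

lemma symbolRep_ι (x : Fin n ⊕ Fin n → ℂ) :
    symbolRep n (CliffordAlgebra.ι _ x) = leftAct n x := CliffordAlgebra.lift_ι_apply _ _ _

/-- The algebra isomorphism between the Clifford algebra and the operators on Fock space. -/
def fockEquiv (n : ℕ) : CliffordAlgebra (modeForm n) ≃ₐ[ℂ] FockOp n :=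
  AlgEquiv.ofBijective (fockRep n) fockRep_bijective

lemma fockEquiv_symm_fieldOp (x : Fin n ⊕ Fin n → ℂ) :
    (fockEquiv n).symm (fieldOp n x) = CliffordAlgebra.ι _ x := by
  rw [AlgEquiv.symm_apply_eq]; exact (fockRep_ι x).symm

/-- The Grassmann mapping `X ↦ X̃`. -/
def symbol (n : ℕ) : FockOp n →ₗ[ℂ] Grassmann n :=
  LinearMap.applyₗ (1 : Grassmann n) ∘ₗ (symbolRep n).toLinearMap ∘ₗ
    (fockEquiv n).symm.toLinearMap

lemma symbol_apply (X : FockOp n) : symbol n X = symbolRep n ((fockEquiv n).symm X) 1 := rfl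

lemma symbol_one : symbol n 1 = 1 := by
  rw [symbol_apply, map_one (fockEquiv n).symm, map_one (symbolRep n)]; rfl

lemma symbol_fieldOp_mul (x : Fin n ⊕ Fin n → ℂ) (X : FockOp n) :
    symbol n (fieldOp n x * X) = leftAct n x (symbol n X) := by
  rw [symbol_apply, map_mul (fockEquiv n).symm, map_mul (symbolRep n), fockEquiv_symm_fieldOp,
    symbolRep_ι]; rfl

/-- Left and right actions agree on scalars, where contraction vanishes, and they commute; so the
formula propagates by building `X` from the left. -/
lemma symbol_mul_fieldOp (x : Fin n ⊕ Fin n → ℂ) (X : FockOp n) :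
    symbol n (X * fieldOp n x) = rightAct x (symbol n X) := by
  obtain ⟨Y, rfl⟩ := (fockEquiv n).surjective X
  induction Y using CliffordAlgebra.left_induction with
  | algebraMap r =>
    rw [AlgEquiv.commutes, Algebra.algebraMap_eq_smul_one, smul_mul_assoc, one_mul, ← mul_one
      (fieldOp n x), map_smul, map_smul, symbol_fieldOp_mul, symbol_one]
    simp [leftAct_apply, rightAct, contr, smul_comm r]
  | add Y Z hY hZ =>
    rw [map_add, add_mul, map_add, hY, hZ, map_add]
    simp only [rightAct, map_add, mul_add]
    module
  | ι_mul Y y hY =>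
    have : fockEquiv n (CliffordAlgebra.ι _ y) = fieldOp n y := fockRep_ι y
    rw [map_mul (fockEquiv n), this, mul_assoc, symbol_fieldOp_mul, symbol_fieldOp_mul, hY,
      leftAct_rightAct]

lemma pairing_single (v : Fin n ⊕ Fin n) :
    pairing n (Pi.single v 1) = LinearMap.proj v.swap := by
  refine LinearMap.ext fun x => ?_
  simp only [pairing_apply, Pi.single_apply, ite_mul, one_mul, zero_mul]
  simp only [Finset.sum_ite_eq', Finset.mem_univ, if_true, LinearMap.proj_apply]

lemma leftAct_inl (j : Fin n) (Y : Grassmann n) : leftAct n (Pi.single (Sum.inl j) 1) Y =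
    invSqrtTwo • (theta j * Y + contr (LinearMap.proj (Sum.inr j)) Y) := by
  rw [leftAct_apply, theta, pairing_single, Sum.swap_inl]

lemma leftAct_inr (j : Fin n) (Y : Grassmann n) : leftAct n (Pi.single (Sum.inr j) 1) Y =
    invSqrtTwo • (thetaBar j * Y + contr (LinearMap.proj (Sum.inl j)) Y) := by
  rw [leftAct_apply, thetaBar, pairing_single, Sum.swap_inr]

lemma contr_theta_mul (d : Module.Dual ℂ (Fin n ⊕ Fin n → ℂ)) (j : Fin n) (Y : Grassmann n) :
    contr d (theta j * Y) = d (Pi.single (Sum.inl j) 1) • Y - theta j * contr d Y :=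
  contr_ι_mul _ _ _

lemma contr_thetaBar_mul (d : Module.Dual ℂ (Fin n ⊕ Fin n → ℂ)) (j : Fin n) (Y : Grassmann n) :
    contr d (thetaBar j * Y) = d (Pi.single (Sum.inr j) 1) • Y - thetaBar j * contr d Y :=
  contr_ι_mul _ _ _

/-- Derivatives in directions absent from a word vanish. This removes the contraction terms when a
factor on a new site is prepended. -/
lemma contr_word {d : Module.Dual ℂ (Fin n ⊕ Fin n → ℂ)} (m : List (Fin n × SiteFactor))
    (hl : ∀ p ∈ m, d (Pi.single (Sum.inl p.1) 1) = 0)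
    (hr : ∀ p ∈ m, d (Pi.single (Sum.inr p.1) 1) = 0) :
    contr d (m.map fun p => p.2.toGrassmann p.1).prod = 0 := by
  induction m with
  | nil => simp [contr]
  | cons p m ih =>
    have hl' := hl p (List.mem_cons_self ..)
    have hr' := hr p (List.mem_cons_self ..)
    have ih' := ih (fun q hq => hl q (List.mem_cons_of_mem _ hq))
      fun q hq => hr q (List.mem_cons_of_mem _ hq)
    rw [List.map_cons, List.prod_cons]
    generalize (m.map fun p => p.2.toGrassmann p.1).prod = W at ih'
    obtain ⟨j, s⟩ := p
    cases s <;> simp only [SiteFactor.toGrassmann, smul_mul_assoc, map_smul, add_mul, one_mul,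
      map_add, mul_assoc, contr_theta_mul, contr_thetaBar_mul, hl', hr', ih'] <;> simp

theorem isGrassmannMapping_symbol : IsGrassmannMapping (symbol n) := by
  intro m hm
  induction m with
  | nil => simpa using symbol_one
  | cons p m ih =>
    rw [List.map_cons, List.nodup_cons] at hm
    have ih := ih hm.2
    rw [List.map_cons, List.prod_cons, List.map_cons, List.prod_cons]
    obtain ⟨j, s⟩ := p
    have hj : ∀ p ∈ m, p.1 ≠ j := fun p hp h => hm.1 (List.mem_map.2 ⟨p, hp, h⟩)
    have h1 := contr_word (d := LinearMap.proj (Sum.inl j)) m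
      (fun p hp => by simp [hj p hp]) (fun p hp => by simp)
    have h2 := contr_word (d := LinearMap.proj (Sum.inr j)) m
      (fun p hp => by simp) (fun p hp => by simp [hj p hp])
    cases s
    · rw [SiteFactor.toOp, ← fieldOp_single_inl, symbol_fieldOp_mul, ih, leftAct_inl, h2,
        add_zero, SiteFactor.toGrassmann, smul_mul_assoc, invSqrtTwo]
    · rw [SiteFactor.toOp, ← fieldOp_single_inr, symbol_fieldOp_mul, ih, leftAct_inr, h1,
        add_zero, SiteFactor.toGrassmann, smul_mul_assoc, invSqrtTwo]
    -- Here one contraction survives: `∂/∂θ_j` hits the `θ_j` just created and yields the `+ 1` of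
    -- the substitution.
    · rw [SiteFactor.toOp, ← fieldOp_single_inl, ← fieldOp_single_inr, mul_assoc,
        symbol_fieldOp_mul, symbol_fieldOp_mul, ih, leftAct_inl, h2, leftAct_inr, add_zero,
        map_smul, mul_smul_comm, ← smul_add, smul_smul, invSqrtTwo_mul_self, contr_theta_mul, h1,
        SiteFactor.toGrassmann, smul_mul_assoc, add_mul]
      simp [mul_assoc]

theorem IsGrassmannMapping.eq_symbol {Φ : FockOp n →ₗ[ℂ] Grassmann n}
    (h : IsGrassmannMapping Φ) : Φ = symbol n := by
  refine LinearMap.ext_on wordSpan_univ ?_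
  rintro X ⟨m, hm, -, rfl⟩
  rw [h m hm, isGrassmannMapping_symbol m hm]

end Mapping

/-! ### The Berezin integral -/

section Berezin

variable {n : ℕ}

/-- Integration over both generators of one site. -/
def intSite (j : Fin n) : Module.End ℂ (Grassmann n) :=
  intVar (Sum.inl j) ∘ₗ intVar (Sum.inr j)

lemma intSite_apply (j : Fin n) (Y : Grassmann n) : intSite j Y =
    contr (LinearMap.proj (Sum.inl j)) (contr (LinearMap.proj (Sum.inr j)) Y) := rfl

lemma berezin_eq (Y : Grassmann n) :
    berezin Y = ExteriorAlgebra.algebraMapInv (((List.finRange n).map intSite).prod Y) := by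
  rw [berezin, List.ofFn_eq_map]; rfl

/-- The Berezin integral as a linear form. -/
def berezinₗ (n : ℕ) : Grassmann n →ₗ[ℂ] ℂ :=
  ExteriorAlgebra.algebraMapInv.toLinearMap ∘ₗ ((List.finRange n).map intSite).prod

lemma berezinₗ_apply (Y : Grassmann n) : berezinₗ n Y = berezin Y := (berezin_eq Y).symm

lemma contr_contr_self (d : Module.Dual ℂ (Fin n ⊕ Fin n → ℂ)) (Y : Grassmann n) :
    contr d (contr d Y) = 0 := CliffordAlgebra.contractLeft_contractLeft _ _

lemma commute_intSite_contr (j : Fin n) (d : Module.Dual ℂ (Fin n ⊕ Fin n → ℂ)) :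
    Commute (intSite j) (contr d) := by
  refine LinearMap.ext fun Y => ?_
  rw [Module.End.mul_apply, Module.End.mul_apply, intSite_apply, intSite_apply,
    contr_contr_comm _ d, map_neg, contr_contr_comm _ d, neg_neg]

lemma intSite_mul_contr_inl (j : Fin n) :
    intSite j * contr (LinearMap.proj (Sum.inl j)) = 0 := by
  refine LinearMap.ext fun Y => ?_
  rw [Module.End.mul_apply, intSite_apply, contr_contr_comm (LinearMap.proj (Sum.inr j)), map_neg,
    contr_contr_self, neg_zero, LinearMap.zero_apply]

lemma intSite_mul_contr_inr (j : Fin n) :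
    intSite j * contr (LinearMap.proj (Sum.inr j)) = 0 := by
  refine LinearMap.ext fun Y => ?_
  rw [Module.End.mul_apply, intSite_apply, contr_contr_self, map_zero, LinearMap.zero_apply]

lemma prod_intSite_mul_contr {d : Module.Dual ℂ (Fin n ⊕ Fin n → ℂ)} {j : Fin n}
    (hj : intSite j * contr d = 0) {l : List (Fin n)} (hl : j ∈ l) :
    (l.map intSite).prod * contr d = 0 := by
  induction l with
  | nil => simp at hl
  | cons i l ih =>
    rw [List.map_cons, List.prod_cons]
    rcases List.mem_cons.1 hl with rfl | h
    · have : Commute (l.map intSite).prod (contr d) := by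
        refine Commute.list_prod_left _ _ fun x hx => ?_
        obtain ⟨k, -, rfl⟩ := List.mem_map.1 hx
        exact commute_intSite_contr k d
      rw [mul_assoc, this.eq, ← mul_assoc, hj, zero_mul]
    · rw [mul_assoc, ih h, mul_zero]

/-- The integral already differentiates in every coordinate direction, derivatives anticommute and
each squares to zero. A general `d` is a combination of coordinate forms. -/
lemma berezin_contr (d : Module.Dual ℂ (Fin n ⊕ Fin n → ℂ)) (Y : Grassmann n) :
    berezin (contr d Y) = 0 := by
  have key : ∀ v : Fin n ⊕ Fin n, berezin (contr (LinearMap.proj v) Y) = 0 := by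
    intro v
    have : ((List.finRange n).map intSite).prod * contr (LinearMap.proj v) = 0 := by
      rcases v with j | j
      · exact prod_intSite_mul_contr (intSite_mul_contr_inl j) (List.mem_finRange j)
      · exact prod_intSite_mul_contr (intSite_mul_contr_inr j) (List.mem_finRange j)
    rw [berezin_eq, ← Module.End.mul_apply, this, LinearMap.zero_apply, map_zero]
  have hd : d = ∑ v, d (Pi.single v 1) •
      (LinearMap.proj v : (Fin n ⊕ Fin n → ℂ) →ₗ[ℂ] ℂ) := by
    refine LinearMap.pi_ext' fun v => LinearMap.ext_ring ?_
    simp only [LinearMap.comp_apply, LinearMap.single_apply, LinearMap.sum_apply,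
      LinearMap.smul_apply, LinearMap.proj_apply, Pi.single_apply, smul_eq_mul, mul_ite, mul_one,
      mul_zero]
    simp only [Finset.sum_ite_eq', Finset.mem_univ, if_true]
  have hc : contr d Y = ∑ v, d (Pi.single v 1) • contr (LinearMap.proj v) Y := by
    conv_lhs => rw [hd]
    simp only [contr, map_sum, map_smul, LinearMap.sum_apply, LinearMap.smul_apply]
  rw [hc, ← berezinₗ_apply, map_sum]
  refine Finset.sum_eq_zero fun v _ => ?_
  rw [map_smul, berezinₗ_apply, key, smul_zero]

lemma berezin_eq_zero_of_contr_eq_zero {d : Module.Dual ℂ (Fin n ⊕ Fin n → ℂ)}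
    {x : Fin n ⊕ Fin n → ℂ} (hx : d x = 1) {Y : Grassmann n} (hY : contr d Y = 0) :
    berezin Y = 0 := by
  have := berezin_contr d (ExteriorAlgebra.ι ℂ x * Y)
  rwa [contr_ι_mul, hx, one_smul, hY, mul_zero, sub_zero] at this

/-- The integral is an even operation, as derivatives come in pairs, and the involution fixes scalar
parts. -/
lemma berezin_involute (Y : Grassmann n) :
    berezin (CliffordAlgebra.involute Y : Grassmann n) = berezin Y := by
  have h1 : ∀ l : List (Fin n), (l.map intSite).prod (CliffordAlgebra.involute Y) =
      CliffordAlgebra.involute ((l.map intSite).prod Y) := by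
    intro l
    induction l with
    | nil => rfl
    | cons j l ih =>
      rw [List.map_cons, List.prod_cons, Module.End.mul_apply, Module.End.mul_apply, ih,
        intSite_apply, intSite_apply, contr_involute, map_neg, contr_involute, neg_neg]
  have h2 : (ExteriorAlgebra.algebraMapInv (R := ℂ) (M := Fin n ⊕ Fin n → ℂ)).comp
      CliffordAlgebra.involute = ExteriorAlgebra.algebraMapInv := by
    refine CliffordAlgebra.hom_ext (LinearMap.ext fun x => ?_)
    have : ExteriorAlgebra.algebraMapInv (R := ℂ) (CliffordAlgebra.ι 0 x : Grassmann n) = 0 := by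
      have := ExteriorAlgebra.lift_ι_apply ℂ (0 : (Fin n ⊕ Fin n → ℂ) →ₗ[ℂ] ℂ) (by simp) x
      exact this
    simp [this]
  rw [berezin_eq, berezin_eq, h1]
  exact DFunLike.congr_fun h2 _

/-! ### The Gaussian weight as a product -/

/-- Even elements are central, so Gaussian computations can use `Finset` products in the commutative
centre. -/
lemma ι_mul_ι_mem_center (x y : Fin n ⊕ Fin n → ℂ) :
    ExteriorAlgebra.ι ℂ x * ExteriorAlgebra.ι ℂ y ∈ Subalgebra.center ℂ (Grassmann n) := by
  rw [Subalgebra.mem_center_iff]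
  intro Z
  have swap : ∀ a b : Fin n ⊕ Fin n → ℂ, ExteriorAlgebra.ι ℂ a * ExteriorAlgebra.ι ℂ b =
      -(ExteriorAlgebra.ι ℂ b * ExteriorAlgebra.ι ℂ a) := fun a b =>
    eq_neg_of_add_eq_zero_left (ExteriorAlgebra.ι_add_mul_swap a b)
  induction Z using ExteriorAlgebra.induction with
  | algebraMap r => exact Algebra.commutes _ _
  | ι z =>
    rw [← mul_assoc, swap z x, neg_mul, mul_assoc, swap z y, mul_neg, neg_neg, mul_assoc]
  | mul a b ha hb => rw [mul_assoc, hb, ← mul_assoc, ha, mul_assoc]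
  | add a b ha hb => rw [add_mul, mul_add, ha, hb]

/-- The inclusion of the span of the `θ_j` into the span of all generators. -/
def thetaIncl (n : ℕ) : (Fin n → ℂ) →ₗ[ℂ] (Fin n ⊕ Fin n → ℂ) where
  toFun y := Sum.elim y 0
  map_add' x y := by ext v; cases v <;> simp
  map_smul' c x := by ext v; cases v <;> simp

lemma thetaIncl_eq_sum (y : Fin n → ℂ) :
    ExteriorAlgebra.ι ℂ (thetaIncl n y) = ∑ l, y l • (theta l : Grassmann n) := by
  simp only [theta, ← map_smul, ← map_sum]
  congr 1
  ext v
  rcases v with i | i <;> simp [thetaIncl, Finset.sum_apply, Pi.single_apply]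

/-- The central element `θ̄_j (∑ l, y_l θ_l)`. -/
def quad (j : Fin n) : (Fin n → ℂ) →ₗ[ℂ] Subalgebra.center ℂ (Grassmann n) :=
  LinearMap.codRestrict (Subalgebra.toSubmodule (Subalgebra.center ℂ (Grassmann n)))
    (LinearMap.mulLeft ℂ (thetaBar j) ∘ₗ ExteriorAlgebra.ι ℂ ∘ₗ thetaIncl n)
    fun _ => ι_mul_ι_mem_center _ _

lemma coe_quad (j : Fin n) (y : Fin n → ℂ) :
    (quad j y : Grassmann n) = thetaBar j * ExteriorAlgebra.ι ℂ (thetaIncl n y) := rfl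

/-- The odd element `∑ l, y_l θ_l` occurs twice. The case `i = j` truncates exponentials; the case
`i ≠ j` makes `topForm` alternating. -/
lemma quad_mul_quad (i j : Fin n) (y : Fin n → ℂ) : quad i y * quad j y = 0 := by
  refine Subtype.ext ?_
  have h : thetaBar j * ExteriorAlgebra.ι ℂ (thetaIncl n y) =
      -(ExteriorAlgebra.ι ℂ (thetaIncl n y) * thetaBar j) :=
    eq_neg_of_add_eq_zero_left (ExteriorAlgebra.ι_add_mul_swap _ _)
  rw [MulMemClass.coe_mul, coe_quad, coe_quad, h, mul_neg, mul_assoc,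
    ← mul_assoc (ExteriorAlgebra.ι ℂ (thetaIncl n y)), ExteriorAlgebra.ι_sq_zero]
  simp

lemma exp_eq_one_add {x : Grassmann n} (hx : x ^ 2 = 0) : IsNilpotent.exp x = 1 + x := by
  rw [IsNilpotent.exp_eq_sum hx]
  simp [Finset.sum_range_succ]

lemma exp_sum_eq_prod {α : Type*} (s : Finset α) (X : α → Subalgebra.center ℂ (Grassmann n))
    (hX : ∀ i, X i ^ 2 = 0) :
    IsNilpotent.exp ((∑ i ∈ s, X i : Subalgebra.center ℂ (Grassmann n)) : Grassmann n) =
      ((∏ i ∈ s, (1 + X i) : Subalgebra.center ℂ (Grassmann n)) : Grassmann n) := by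
  classical
  induction s using Finset.induction_on with
  | empty => simp
  | insert i s hi ih =>
    have hnil : IsNilpotent (∑ i ∈ s, X i) := isNilpotent_sum fun j _ => ⟨2, hX j⟩
    have h2 : (X i : Grassmann n) ^ 2 = 0 := congrArg Subtype.val (hX i)
    rw [Finset.sum_insert hi, Finset.prod_insert hi, AddMemClass.coe_add,
      IsNilpotent.exp_add_of_commute (congrArg Subtype.val (mul_comm (X i) (∑ i ∈ s, X i)))
        ⟨2, h2⟩ (hnil.map (Subalgebra.center ℂ (Grassmann n)).val), ih, exp_eq_one_add h2]
    rfl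

lemma gaussWeight_eq_prod (h : Matrix (Fin n) (Fin n) ℂ) : gaussWeight h =
    ((∏ j, (1 + quad j (-h j)) : Subalgebra.center ℂ (Grassmann n)) : Grassmann n) := by
  rw [← exp_sum_eq_prod _ _ fun i => by rw [sq, quad_mul_quad], gaussWeight]
  congr 1
  rw [AddSubmonoidClass.coe_finsetSum, ← Finset.sum_neg_distrib]
  refine Finset.sum_congr rfl fun j _ => ?_
  rw [coe_quad, map_neg, map_neg, thetaIncl_eq_sum, mul_neg, Finset.mul_sum]
  simp

lemma gaussWeight_comm (h : Matrix (Fin n) (Fin n) ℂ) (Y : Grassmann n) :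
    Y * gaussWeight h = gaussWeight h * Y := by
  rw [gaussWeight_eq_prod]
  exact Subalgebra.mem_center_iff.1 (SetLike.coe_mem _) Y

/-- The contraction of `θ̄_j (∑ l, y_l θ_l)` with a linear form. -/
def quadContr (d : Module.Dual ℂ (Fin n ⊕ Fin n → ℂ)) (j : Fin n) (y : Fin n → ℂ) :
    Grassmann n :=
  d (Pi.single (Sum.inr j) 1) • ExteriorAlgebra.ι ℂ (thetaIncl n y) -
    d (thetaIncl n y) • thetaBar j

lemma contr_quad_mul (d : Module.Dual ℂ (Fin n ⊕ Fin n → ℂ)) (j : Fin n) (y : Fin n → ℂ)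
    (Y : Grassmann n) :
    contr d (quad j y * Y) = quadContr d j y * Y + quad j y * contr d Y := by
  rw [coe_quad, mul_assoc, contr_thetaBar_mul, contr_ι_mul, quadContr]
  simp only [sub_mul, mul_sub, mul_smul_comm, smul_mul_assoc, mul_assoc]
  abel

lemma quadContr_mul_quad (d : Module.Dual ℂ (Fin n ⊕ Fin n → ℂ)) (j : Fin n) (y : Fin n → ℂ) :
    quadContr d j y * quad j y = 0 := by
  have h : thetaBar j * ExteriorAlgebra.ι ℂ (thetaIncl n y) =
      -(ExteriorAlgebra.ι ℂ (thetaIncl n y) * thetaBar j) :=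
    eq_neg_of_add_eq_zero_left (ExteriorAlgebra.ι_add_mul_swap _ _)
  have h' : (thetaBar j : Grassmann n) * thetaBar j = 0 := ExteriorAlgebra.ι_sq_zero _
  rw [coe_quad, quadContr, sub_mul, smul_mul_assoc, smul_mul_assoc, ← mul_assoc (thetaBar j), h',
    h, mul_neg, ← mul_assoc, ExteriorAlgebra.ι_sq_zero]
  simp

/-- A logarithmic derivative: for `q = quad j (η j)` with derivative `q'`, `q' q = 0` gives `(1 +
q)' = q' = (1 + q) q'`. -/
lemma contr_prod_mul (d : Module.Dual ℂ (Fin n ⊕ Fin n → ℂ)) (η : Fin n → Fin n → ℂ)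
    (s : Finset (Fin n)) (Y : Grassmann n) :
    contr d (((∏ j ∈ s, (1 + quad j (η j)) : Subalgebra.center ℂ (Grassmann n)) : Grassmann n) * Y)
      = ((∏ j ∈ s, (1 + quad j (η j)) : Subalgebra.center ℂ (Grassmann n)) : Grassmann n) *
        ((∑ j ∈ s, quadContr d j (η j)) * Y + contr d Y) := by
  induction s using Finset.induction_on with
  | empty => simp
  | insert i s hi ih =>
    rw [Finset.prod_insert hi, Finset.sum_insert hi, MulMemClass.coe_mul]
    set P := ((∏ j ∈ s, (1 + quad j (η j)) : Subalgebra.center ℂ (Grassmann n)) : Grassmann n)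
    have hPc : ∀ Z, Z * P = P * Z :=
      Subalgebra.mem_center_iff.1 (SetLike.coe_mem (∏ j ∈ s, (1 + quad j (η j))))
    have hX := Subalgebra.mem_center_iff.1 (SetLike.coe_mem (quad i (η i)))
    have h0 : (quad i (η i) : Grassmann n) * quadContr d i (η i) = 0 := by
      rw [← hX, quadContr_mul_quad]
    have h1 : ((1 + quad i (η i) : Subalgebra.center ℂ (Grassmann n)) : Grassmann n) =
      1 + quad i (η i) := rfl
    have h2 : quadContr d i (η i) * (P * Y) = P * (quadContr d i (η i) * Y) := by
      rw [← mul_assoc, hPc, mul_assoc]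
    have h3 : (quad i (η i) : Grassmann n) * (P * (quadContr d i (η i) * Y)) = 0 := by
      rw [← h2, ← mul_assoc, h0, zero_mul]
    rw [h1, mul_assoc, add_mul, one_mul, map_add, contr_quad_mul, ih, h2]
    simp only [add_mul, mul_add, one_mul, mul_assoc, h3]
    abel

lemma contr_gaussWeight_mul (h : Matrix (Fin n) (Fin n) ℂ)
    (d : Module.Dual ℂ (Fin n ⊕ Fin n → ℂ)) (Y : Grassmann n) :
    contr d (gaussWeight h * Y) =
      gaussWeight h * (contr d Y - (∑ j, quadContr d j (h j)) * Y) := by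
  rw [gaussWeight_eq_prod, contr_prod_mul]
  have : ∀ j, quadContr d j (-h j) = -quadContr d j (h j) := by
    intro j
    simp only [quadContr, map_neg, smul_neg, neg_smul]
    abel
  simp only [this, Finset.sum_neg_distrib, neg_mul]
  rw [neg_add_eq_sub]

/-- The unnormalized Gaussian average of a Grassmann element. -/
def gaussAverage (h : Matrix (Fin n) (Fin n) ℂ) : Grassmann n →ₗ[ℂ] ℂ :=
  berezinₗ n ∘ₗ LinearMap.mulRight ℂ (gaussWeight h)

lemma gaussAverage_apply (h : Matrix (Fin n) (Fin n) ℂ) (Y : Grassmann n) :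
    gaussAverage h Y = berezin (Y * gaussWeight h) := berezinₗ_apply _

/-- The Schwinger–Dyson equation. -/
lemma gaussAverage_contr (h : Matrix (Fin n) (Fin n) ℂ)
    (d : Module.Dual ℂ (Fin n ⊕ Fin n → ℂ)) (Y : Grassmann n) :
    gaussAverage h (contr d Y) = gaussAverage h ((∑ j, quadContr d j (h j)) * Y) := by
  have := berezin_contr d (gaussWeight h * Y)
  rwa [contr_gaussWeight_mul, ← gaussWeight_comm, ← gaussAverage_apply, map_sub,
    sub_eq_zero] at this

lemma involute_gaussWeight (h : Matrix (Fin n) (Fin n) ℂ) :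
    CliffordAlgebra.involute (gaussWeight h) = gaussWeight h := by
  have h0 : ∀ j y, CliffordAlgebra.involute ((1 + quad j y : Subalgebra.center ℂ (Grassmann n)) :
      Grassmann n) = ((1 + quad j y : Subalgebra.center ℂ (Grassmann n)) : Grassmann n) := by
    intro j y
    have e1 : CliffordAlgebra.involute (thetaBar j : Grassmann n) = -thetaBar j :=
      CliffordAlgebra.involute_ι _
    have e2 : CliffordAlgebra.involute (ExteriorAlgebra.ι ℂ (thetaIncl n y)) =
      -ExteriorAlgebra.ι ℂ (thetaIncl n y) := CliffordAlgebra.involute_ι _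
    rw [AddMemClass.coe_add, coe_quad, map_add, map_mul, e1, e2, neg_mul_neg]
    simp
  rw [gaussWeight_eq_prod]
  refine Finset.prod_induction _ (fun Z : Subalgebra.center ℂ (Grassmann n) =>
    CliffordAlgebra.involute (Z : Grassmann n) = (Z : Grassmann n)) ?_ ?_ ?_
  · intro a b ha hb
    rw [MulMemClass.coe_mul, map_mul, ha, hb]
  · simp
  · intro j _
    exact h0 j _

lemma gaussAverage_involute (h : Matrix (Fin n) (Fin n) ℂ) (Y : Grassmann n) :
    gaussAverage h (CliffordAlgebra.involute Y) = gaussAverage h Y := by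
  rw [gaussAverage_apply, gaussAverage_apply, ← berezin_involute (Y * _), map_mul,
    involute_gaussWeight]

/-! ### The Gaussian integral is a determinant -/

lemma contr_prod_quad_eq_zero {d : Module.Dual ℂ (Fin n ⊕ Fin n → ℂ)}
    (hd : ∀ y, d (thetaIncl n y) = 0) (η : Fin n → Fin n → ℂ) (s : Finset (Fin n))
    (hs : ∀ j ∈ s, d (Pi.single (Sum.inr j) 1) = 0) :
    contr d ((∏ j ∈ s, quad j (η j) : Subalgebra.center ℂ (Grassmann n)) : Grassmann n) = 0 := by
  induction s using Finset.induction_on with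
  | empty => simp [contr]
  | insert i s hi ih =>
    rw [Finset.prod_insert hi, MulMemClass.coe_mul, contr_quad_mul,
      ih fun j hj => hs j (Finset.mem_insert_of_mem hj), quadContr, hd,
      hs i (Finset.mem_insert_self _ _)]
    simp

/-- When the product is expanded, every term but the full one misses some `θ̄_j` and integrates to
zero. -/
lemma berezin_prod_one_add_quad (η : Fin n → Fin n → ℂ) :
    berezin ((∏ j, (1 + quad j (η j)) : Subalgebra.center ℂ (Grassmann n)) : Grassmann n) =
      berezin ((∏ j, quad j (η j) : Subalgebra.center ℂ (Grassmann n)) : Grassmann n) := by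
  rw [Finset.prod_one_add, AddSubmonoidClass.coe_finsetSum, ← berezinₗ_apply, map_sum,
    Finset.sum_eq_single Finset.univ, berezinₗ_apply]
  · intro s _ hs
    obtain ⟨j, hj⟩ : ∃ j, j ∉ s := by
      by_contra! h
      exact hs (Finset.eq_univ_iff_forall.2 h)
    rw [berezinₗ_apply]
    refine berezin_eq_zero_of_contr_eq_zero (d := LinearMap.proj (Sum.inr j))
      (x := Pi.single (Sum.inr j) 1) (by simp) (contr_prod_quad_eq_zero ?_ _ _ ?_)
    · intro y; rfl
    · intro i hi
      have : i ≠ j := fun h => hj (h ▸ hi)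
      simp [this]
  · simp

lemma prod_intSite_prod_quad (l : List (Fin n)) (hl : l.Nodup) (Z : Grassmann n)
    (hZl : ∀ j ∈ l, contr (LinearMap.proj (Sum.inl j)) Z = 0)
    (hZr : ∀ j ∈ l, contr (LinearMap.proj (Sum.inr j)) Z = 0) :
    (l.map intSite).prod (((l.map fun j => quad j (Pi.single j 1)).prod :
      Subalgebra.center ℂ (Grassmann n)) * Z) = Z := by
  induction l generalizing Z with
  | nil => simp
  | cons j l ih =>
    rw [List.nodup_cons] at hl
    have hq : ((quad j (Pi.single j 1) : Subalgebra.center ℂ (Grassmann n)) : Grassmann n) =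
        thetaBar j * theta j := by
      rw [coe_quad, thetaIncl_eq_sum]
      simp [Pi.single_apply]
    have hne : ∀ i ∈ l, i ≠ j := fun i hi h => hl.1 (h ▸ hi)
    -- The integral over site `j` is performed last, so the central factor `θ̄_j θ_j` is absorbed
    -- into `Z` and the induction hypothesis is used for the enlarged `Z`.
    rw [List.map_cons, List.prod_cons, List.map_cons, List.prod_cons, Module.End.mul_apply,
      mul_comm, MulMemClass.coe_mul, mul_assoc, ih hl.2, hq, intSite_apply, mul_assoc,
      contr_thetaBar_mul, contr_theta_mul, hZr j (by simp)]
    · simp [contr_theta_mul, hZl j]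
    · intro i hi
      rw [hq, mul_assoc, contr_thetaBar_mul, contr_theta_mul, hZl i (by simp [hi])]
      simp [hne i hi]
    · intro i hi
      rw [hq, mul_assoc, contr_thetaBar_mul, contr_theta_mul, hZr i (by simp [hi])]
      simp [hne i hi]

/-- The Berezin integral of `∏ j, θ̄_j (∑ l, η_jl θ_l)` as an alternating form in the rows. -/
def topForm (n : ℕ) : (Fin n → ℂ) [⋀^Fin n]→ₗ[ℂ] ℂ where
  toMultilinearMap := (berezinₗ n ∘ₗ (Subalgebra.center ℂ (Grassmann n)).val.toLinearMap
    ).compMultilinearMap ((MultilinearMap.mkPiAlgebra ℂ (Fin n)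
      (Subalgebra.center ℂ (Grassmann n))).compLinearMap quad)
  map_eq_zero_of_eq' η i j hij hne := by
    have : ∏ k, quad k (η k) = 0 := by
      rw [← Finset.mul_prod_erase _ _ (Finset.mem_univ i), ← Finset.mul_prod_erase _ _
        (Finset.mem_erase.2 ⟨hne.symm, Finset.mem_univ j⟩), ← mul_assoc, hij, quad_mul_quad,
        zero_mul]
    simp [this]

lemma topForm_apply (η : Fin n → Fin n → ℂ) : topForm n η =
    berezin ((∏ j, quad j (η j) : Subalgebra.center ℂ (Grassmann n)) : Grassmann n) := by
  rw [← berezinₗ_apply]; rfl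

lemma topForm_single : topForm n (fun j => Pi.single j 1) = 1 := by
  have := prod_intSite_prod_quad (List.finRange n) (List.nodup_finRange n) 1
    (by simp [contr]) (by simp [contr])
  rw [mul_one, ← List.ofFn_eq_map (f := fun j => quad j (Pi.single j 1)), List.prod_ofFn] at this
  rw [topForm_apply, berezin_eq, this, map_one]

/-- An alternating `n`-form on `ℂⁿ` is its value on the standard basis times the determinant; here
that value is `1` and the rows are those of `-h`. -/
theorem berezin_gaussWeight (h : Matrix (Fin n) (Fin n) ℂ) :
    berezin (gaussWeight h) = (-h).det := by
  rw [gaussWeight_eq_prod, berezin_prod_one_add_quad, ← topForm_apply,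
    (topForm n).eq_smul_basis_det (Pi.basisFun ℂ (Fin n))]
  have : topForm n (Pi.basisFun ℂ (Fin n)) = 1 := by
    rw [← topForm_single]
    congr 1
    ext j
    simp
  rw [this, one_smul, Pi.basisFun_det]
  rfl

end Berezin

/-! ### The thermal state -/

section Thermal

variable {n : ℕ}

/-! ### Commutation of `Ĥ` and the Boltzmann operator with eigenmodes. -/

lemma fieldOp_sum_inl (x : Fin n → ℂ) :
    fieldOp n (Sum.elim x (0 : Fin n → ℂ)) = ∑ l, x l • ann l := by
  simp [fieldOp, Fintype.linearCombination_apply]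

lemma fieldOp_sum_inr (y : Fin n → ℂ) :
    fieldOp n (Sum.elim (0 : Fin n → ℂ) y) = ∑ l, y l • cre l := by
  simp [fieldOp, Fintype.linearCombination_apply]

lemma number_mul_ann (i j l : Fin n) : cre i * ann j * ann l =
    ann l * (cre i * ann j) - if i = l then ann j else 0 := by
  have h1 : ann j * ann l = -(ann l * ann j) := eq_neg_of_add_eq_zero_left (ann_mul_ann_add j l)
  have h2 : cre i * ann l = (if l = i then 1 else 0) - ann l * cre i :=
    eq_sub_of_add_eq' (ann_mul_cre_add l i)
  rw [mul_assoc, h1, mul_neg, ← mul_assoc, h2, sub_mul, mul_assoc]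
  simp only [eq_comm (a := l)]
  split_ifs <;> simp

lemma number_mul_cre (i j l : Fin n) : cre i * ann j * cre l =
    cre l * (cre i * ann j) + if j = l then cre i else 0 := by
  have h1 : cre i * cre l = -(cre l * cre i) := eq_neg_of_add_eq_zero_left (cre_mul_cre_add i l)
  have h2 : ann j * cre l = (if j = l then 1 else 0) - cre l * ann j :=
    eq_sub_of_add_eq (ann_mul_cre_add j l)
  rw [mul_assoc, h2, mul_sub, ← mul_assoc (cre i), h1]
  split_ifs <;> simp [mul_assoc, add_comm]

lemma hamiltonian_mul_ann (H : Matrix (Fin n) (Fin n) ℂ) (l : Fin n) :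
    hamiltonian H * ann l = ann l * hamiltonian H - ∑ m, H l m • ann m := by
  simp only [hamiltonian, Finset.sum_mul, Finset.mul_sum, smul_mul_assoc, mul_smul_comm,
    number_mul_ann, smul_sub, Finset.sum_sub_distrib]
  congr 1
  rw [Finset.sum_comm]
  refine Finset.sum_congr rfl fun m _ => ?_
  simp

lemma hamiltonian_mul_cre (H : Matrix (Fin n) (Fin n) ℂ) (l : Fin n) :
    hamiltonian H * cre l = cre l * hamiltonian H + ∑ m, H m l • cre m := by
  simp only [hamiltonian, Finset.sum_mul, Finset.mul_sum, smul_mul_assoc, mul_smul_comm,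
    number_mul_cre, smul_add, Finset.sum_add_distrib]
  congr 1
  refine Finset.sum_congr rfl fun m _ => ?_
  simp

lemma hamiltonian_mul_fieldOp_inl {H : Matrix (Fin n) (Fin n) ℂ} {x : Fin n → ℂ} {ε : ℂ}
    (hx : x ᵥ* H = ε • x) :
    hamiltonian H * fieldOp n (Sum.elim x (0 : Fin n → ℂ)) =
      fieldOp n (Sum.elim x (0 : Fin n → ℂ)) * hamiltonian H -
        ε • fieldOp n (Sum.elim x (0 : Fin n → ℂ)) := by
  rw [fieldOp_sum_inl, Finset.mul_sum, Finset.sum_mul, Finset.smul_sum]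
  simp only [mul_smul_comm, hamiltonian_mul_ann, smul_sub, Finset.sum_sub_distrib, smul_mul_assoc,
    Finset.smul_sum]
  congr 1
  rw [Finset.sum_comm]
  refine Finset.sum_congr rfl fun m _ => ?_
  have := congrFun hx m
  simp only [Matrix.vecMul, dotProduct, Pi.smul_apply, smul_eq_mul] at this
  simp only [smul_smul, ← Finset.sum_smul, this]

lemma hamiltonian_mul_fieldOp_inr {H : Matrix (Fin n) (Fin n) ℂ} {y : Fin n → ℂ} {ε : ℂ}
    (hy : H *ᵥ y = ε • y) :
    hamiltonian H * fieldOp n (Sum.elim (0 : Fin n → ℂ) y) =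
      fieldOp n (Sum.elim (0 : Fin n → ℂ) y) * hamiltonian H +
        ε • fieldOp n (Sum.elim (0 : Fin n → ℂ) y) := by
  rw [fieldOp_sum_inr, Finset.mul_sum, Finset.sum_mul, Finset.smul_sum]
  simp only [mul_smul_comm, hamiltonian_mul_cre, smul_add, Finset.sum_add_distrib, smul_mul_assoc,
    Finset.smul_sum]
  congr 1
  rw [Finset.sum_comm]
  refine Finset.sum_congr rfl fun m _ => ?_
  have := congrFun hy m
  simp only [Matrix.mulVec, dotProduct, Pi.smul_apply, smul_eq_mul] at this
  simp only [smul_smul, ← Finset.sum_smul, ← this]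
  congr 1
  exact Finset.sum_congr rfl fun i _ => mul_comm _ _

lemma matrix_exp_semiconj {ι : Type*} [Fintype ι] [DecidableEq ι] {A M N : Matrix ι ι ℂ}
    (h : SemiconjBy A M N) : SemiconjBy A (NormedSpace.exp M) (NormedSpace.exp N) := by
  open scoped Matrix.Norms.Operator in exact h.exp_right

/-- The hypothesis says that `A` intertwines `Ĥ - ε` with `Ĥ`, hence also their exponentials, and
the scalar shift factors out. -/
lemma boltzmann_mul {β : ℝ} {H : Matrix (Fin n) (Fin n) ℂ} {A : FockOp n} {ε : ℂ}
    (hA : hamiltonian H * A = A * hamiltonian H - ε • A) :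
    boltzmann β H * A = Complex.exp (β * ε) • (A * boltzmann β H) := by
  have h1 : SemiconjBy A ((-((β : ℂ) • hamiltonian H)) + Matrix.diagonal fun _ => (β * ε : ℂ))
      (-((β : ℂ) • hamiltonian H)) := by
    have h0 : (Matrix.diagonal fun _ => (β * ε : ℂ) : FockOp n) = (β * ε : ℂ) • 1 := by
      rw [← Matrix.smul_one_eq_diagonal]
    rw [SemiconjBy, h0, mul_add, neg_mul, smul_mul_assoc, hA, mul_neg, mul_smul_comm,
      mul_smul_comm, mul_one, smul_sub, mul_smul]
    abel
  have h2 := (matrix_exp_semiconj h1).eq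
  rw [Matrix.exp_add_of_commute, Matrix.exp_diagonal] at h2
  · have h3 : (Matrix.diagonal (NormedSpace.exp fun _ : Finset (Fin n) => (β * ε : ℂ)) :
        FockOp n) = Complex.exp (β * ε) • 1 := by
      rw [Pi.exp_def, ← Complex.exp_eq_exp_ℂ, ← Matrix.smul_one_eq_diagonal]
    rw [h3, mul_smul_comm, mul_one, mul_smul_comm] at h2
    exact h2.symm
  · rw [← Matrix.smul_one_eq_diagonal]
    exact (Commute.one_right _).smul_right _

lemma isUnit_boltzmann (β : ℝ) (H : Matrix (Fin n) (Fin n) ℂ) : IsUnit (boltzmann β H) :=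
  Matrix.isUnit_exp _

/-- An operator that commutes with all annihilation and creation operators is a scalar. -/
lemma exists_eq_smul_one_of_commute {C : FockOp n} (ha : ∀ j, Commute (ann j) C)
    (hc : ∀ j, Commute (cre j) C) : ∃ c : ℂ, C = c • 1 := by
  have h : ∀ X, Commute X C := by
    intro X
    have hle : wordSpan Finset.univ ≤
        Subalgebra.toSubmodule (Subalgebra.centralizer ℂ ({C} : Set (FockOp n))) := by
      refine Submodule.span_le.2 ?_
      rintro _ ⟨m, -, -, rfl⟩
      refine Subalgebra.list_prod_mem _ fun X hX => ?_
      obtain ⟨⟨j, s⟩, -, rfl⟩ := List.mem_map.1 hX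
      rw [Subalgebra.mem_centralizer_iff]
      rintro _ rfl
      cases s
      · exact (ha j).symm
      · exact (hc j).symm
      · exact ((hc j).mul_left (ha j)).symm
    have := hle (wordSpan_univ.symm ▸ Submodule.mem_top : X ∈ wordSpan Finset.univ)
    exact ((Subalgebra.mem_centralizer_iff ℂ).1 this C rfl).symm
  obtain ⟨c, hc⟩ := Matrix.mem_range_scalar_of_commute_single (M := C) fun i j _ => h _
  refine ⟨c, ?_⟩
  rw [← hc, Matrix.scalar_apply, Matrix.smul_one_eq_diagonal]

lemma exists_trace_mul_eq (f : FockOp n →ₗ[ℂ] ℂ) : ∃ D : FockOp n, ∀ X, f X = (X * D).trace := by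
  refine ⟨Matrix.of fun T S => f (Matrix.single S T 1), fun X => ?_⟩
  conv_lhs => rw [Matrix.matrix_eq_sum_single X]
  simp only [map_sum, Matrix.trace, Matrix.diag, Matrix.mul_apply, Matrix.of_apply]
  refine Finset.sum_congr rfl fun S _ => Finset.sum_congr rfl fun T _ => ?_
  rw [← mul_one (X S T), ← smul_eq_mul, ← Matrix.smul_single, map_smul, smul_eq_mul, smul_eq_mul,
    mul_one]

/-- With `m` the average of `v Y`, integration by parts turns the average of `∂_v Y` into `κ m`. The
left action then averages to `(κ + 1) m / √2` and the right action to `(κ - 1) m / √2`, the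
involutions costing only signs. -/
lemma gaussAverage_symbol_kms {h : Matrix (Fin n) (Fin n) ℂ} {v : Fin n ⊕ Fin n → ℂ}
    {κ lam : ℂ} (hv : ∑ j, quadContr (pairing n v) j (h j) = κ • ExteriorAlgebra.ι ℂ v)
    (hlam : lam * (κ - 1) = κ + 1) (X : FockOp n) :
    gaussAverage h (symbol n (fieldOp n v * X)) =
      lam * gaussAverage h (symbol n (X * fieldOp n v)) := by
  rw [symbol_fieldOp_mul, symbol_mul_fieldOp, leftAct_apply, rightAct]
  set Y := symbol n X
  have hinv : CliffordAlgebra.involute (ExteriorAlgebra.ι ℂ v) = -ExteriorAlgebra.ι ℂ v :=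
    CliffordAlgebra.involute_ι _
  have h1 : ExteriorAlgebra.ι ℂ v * CliffordAlgebra.involute Y =
      -CliffordAlgebra.involute (ExteriorAlgebra.ι ℂ v * Y) := by
    rw [map_mul, hinv, neg_mul, neg_neg]
  rw [h1, contr_involute, map_smul, map_smul, map_add, map_sub, map_neg, map_neg,
    gaussAverage_involute, gaussAverage_involute, gaussAverage_contr, hv, smul_mul_assoc, map_smul,
    smul_eq_mul, smul_eq_mul, smul_eq_mul]
  linear_combination -invSqrtTwo * gaussAverage h (ExteriorAlgebra.ι ℂ v * Y) * hlam

lemma sum_quadContr_inl {h : Matrix (Fin n) (Fin n) ℂ} {x : Fin n → ℂ} {κ : ℂ}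
    (hx : x ᵥ* h = κ • x) :
    ∑ j, quadContr (pairing n (Sum.elim x (0 : Fin n → ℂ))) j (h j) =
      κ • ExteriorAlgebra.ι ℂ (Sum.elim x (0 : Fin n → ℂ)) := by
  have h1 : ∀ j, quadContr (pairing n (Sum.elim x (0 : Fin n → ℂ))) j (h j) =
      x j • ExteriorAlgebra.ι ℂ (thetaIncl n (h j)) := by
    intro j
    simp [quadContr, pairing_apply, thetaIncl, Pi.single_apply]
  simp only [h1, ← map_smul, ← map_sum]
  congr 1
  have : ∑ j, x j • h j = κ • x := by
    rw [← hx]; ext i; simp [Matrix.vecMul, dotProduct]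
  rw [this]
  ext v
  cases v <;> simp [thetaIncl]

lemma sum_quadContr_inr {h : Matrix (Fin n) (Fin n) ℂ} {y : Fin n → ℂ} {κ : ℂ}
    (hy : h *ᵥ y = κ • y) :
    ∑ j, quadContr (pairing n (Sum.elim (0 : Fin n → ℂ) y)) j (h j) =
      (-κ) • ExteriorAlgebra.ι ℂ (Sum.elim (0 : Fin n → ℂ) y) := by
  have h1 : ∀ j, quadContr (pairing n (Sum.elim (0 : Fin n → ℂ) y)) j (h j) =
      -((κ * y j) • thetaBar j) := by
    intro j
    have := congrFun hy j
    simp only [Matrix.mulVec, dotProduct, Pi.smul_apply, smul_eq_mul] at this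
    simp [quadContr, pairing_apply, thetaIncl, ← this, mul_comm]
  simp only [h1, thetaBar, ← map_smul, ← map_sum, ← map_neg]
  congr 1
  ext v
  rcases v with i | i <;> simp [Finset.sum_apply, Pi.single_apply]

/-! ### The link matrix -/

lemma linkMatrix_eq {H : Matrix (Fin n) (Fin n) ℂ} (hH : H.IsHermitian) (β : ℝ) :
    linkMatrix β H = (hH.eigenvectorUnitary : Matrix (Fin n) (Fin n) ℂ) *
      diagonal (fun k => ((Real.cosh (β / 2 * hH.eigenvalues k) /
        Real.sinh (β / 2 * hH.eigenvalues k) : ℝ) : ℂ)) *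
      star (hH.eigenvectorUnitary : Matrix (Fin n) (Fin n) ℂ) := by
  -- Every function is continuous on a finite spectrum, so the singularity of `coth` at `0` is no
  -- obstacle here.
  have hf : Set.Finite (((β / 2) • ·) '' spectrum ℝ H) :=
    Matrix.finite_real_spectrum.image _
  have h1 : linkMatrix β H =
      cfc (fun x : ℝ => Real.cosh ((β / 2) • x) / Real.sinh ((β / 2) • x)) H :=
    (cfc_comp_smul (β / 2) (fun x : ℝ => Real.cosh x / Real.sinh x) H
      (hf.continuousOn _) hH).symm
  rw [h1, hH.cfc_eq, Matrix.IsHermitian.cfc, Unitary.conjStarAlgAut_apply]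
  rfl

lemma vecMul_of_diagonalized {U M : Matrix (Fin n) (Fin n) ℂ} (hU : star U * U = 1)
    {d : Fin n → ℂ} (hM : M = U * diagonal d * star U) (k : Fin n) :
    (star U) k ᵥ* M = d k • (star U) k := by
  have : star U * M = diagonal d * star U := by
    rw [hM, mul_assoc, ← mul_assoc, hU, one_mul]
  ext m
  have := congrFun (congrFun this k) m
  rwa [Matrix.diagonal_mul] at this

lemma mulVec_of_diagonalized {U M : Matrix (Fin n) (Fin n) ℂ} (hU : star U * U = 1)
    {d : Fin n → ℂ} (hM : M = U * diagonal d * star U) (k : Fin n) :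
    M *ᵥ (fun m => U m k) = d k • fun m => U m k := by
  have : M * U = U * diagonal d := by
    rw [hM, mul_assoc, hU, mul_one]
  ext m
  have := congrFun (congrFun this m) k
  rw [Matrix.mul_diagonal] at this
  rw [Pi.smul_apply, smul_eq_mul, mul_comm]
  exact this

lemma exp_mul_coth_sub_one {t : ℝ} (ht : t ≠ 0) :
    Real.exp (2 * t) * (Real.cosh t / Real.sinh t - 1) = Real.cosh t / Real.sinh t + 1 := by
  have hs : Real.sinh t ≠ 0 := Real.sinh_ne_zero.2 ht
  have h1 : Real.cosh t - Real.sinh t = Real.exp (-t) := Real.cosh_sub_sinh t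
  have h2 : Real.cosh t + Real.sinh t = Real.exp t := Real.cosh_add_sinh t
  rw [div_sub_one hs, div_add_one hs, h1, h2, mul_div_assoc', ← Real.exp_add]
  congr 2
  ring

/-- The Gaussian average of symbols is proportional to the thermal state. -/
theorem exists_gaussAverage_symbol_eq {H : Matrix (Fin n) (Fin n) ℂ} (hH : H.IsHermitian)
    (hgap : ∀ k, hH.eigenvalues k ≠ 0) {β : ℝ} (hβ : β ≠ 0) :
    ∃ c : ℂ, ∀ X, gaussAverage (linkMatrix β H) (symbol n X) = c * (X * boltzmann β H).trace := by
  obtain ⟨D, hD⟩ := exists_trace_mul_eq (gaussAverage (linkMatrix β H) ∘ₗ symbol n)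
  replace hD : ∀ X, gaussAverage (linkMatrix β H) (symbol n X) = (X * D).trace := hD
  set U : Matrix (Fin n) (Fin n) ℂ := (hH.eigenvectorUnitary : Matrix (Fin n) (Fin n) ℂ) with hUdef
  have hU : star U * U = 1 := Unitary.coe_star_mul_self _
  have hU' : U * star U = 1 := Unitary.coe_mul_star_self _
  have hHU : H = U * diagonal (fun k => (hH.eigenvalues k : ℂ)) * star U := by
    conv_lhs => rw [hH.spectral_theorem, Unitary.conjStarAlgAut_apply]
    rfl
  have hLU := linkMatrix_eq hH β
  rw [← hUdef] at hLU
  set ρ := boltzmann β H with hρ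
  set κ : Fin n → ℝ := fun k => Real.cosh (β / 2 * hH.eigenvalues k) /
    Real.sinh (β / 2 * hH.eigenvalues k)
  have hκ1 : ∀ k, Complex.exp (β * hH.eigenvalues k) * ((κ k : ℂ) - 1) = κ k + 1 := by
    intro k
    have := exp_mul_coth_sub_one (mul_ne_zero (div_ne_zero hβ two_ne_zero) (hgap k))
    rw [show 2 * (β / 2 * hH.eigenvalues k) = β * hH.eigenvalues k by ring] at this
    exact_mod_cast this
  -- Creation modes use the same identity inverted: `ε` and `κ` both change sign.
  have hκ2 : ∀ k, Complex.exp (β * (-hH.eigenvalues k)) * (-(κ k : ℂ) - 1) = -κ k + 1 := by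
    intro k
    have h0 : Complex.exp (β * (-hH.eigenvalues k)) * Complex.exp (β * hH.eigenvalues k) = 1 := by
      rw [← Complex.exp_add]; simp
    linear_combination Complex.exp (β * (-hH.eigenvalues k)) * hκ1 k - ((κ k : ℂ) - 1) * h0
  obtain ⟨ρi, hρi⟩ := (isUnit_boltzmann β H).exists_left_inv
  rw [← hρ] at hρi
  -- If `ρ` and `D` have the same exchange factor with `A`, the factors cancel in `ρ⁻¹ D`. For `D`
  -- the exchange rule follows from cyclicity and nondegeneracy of the trace.
  have hρi' : ρ * ρi = 1 := mul_eq_one_comm.1 hρi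
  have key : ∀ (A : FockOp n) (lam : ℂ), ρ * A = lam • (A * ρ) →
      (∀ X, gaussAverage (linkMatrix β H) (symbol n (A * X)) =
        lam * gaussAverage (linkMatrix β H) (symbol n (X * A))) → Commute A (ρi * D) := by
    intro A lam h1 h2
    have h3 : D * A = lam • (A * D) := by
      rw [Matrix.ext_iff_trace_mul_left]
      intro X
      have := h2 X
      rw [hD, hD] at this
      rw [mul_smul_comm, Matrix.trace_smul, ← mul_assoc, ← mul_assoc, Matrix.trace_mul_comm,
        ← mul_assoc, this, smul_eq_mul]
    have h4 : A * ρi = lam • (ρi * A) := by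
      calc A * ρi = ρi * (ρ * A) * ρi := by rw [← mul_assoc, hρi, one_mul]
        _ = lam • (ρi * A * (ρ * ρi)) := by
          rw [h1, mul_smul_comm, smul_mul_assoc, mul_assoc, mul_assoc, mul_assoc]
        _ = lam • (ρi * A) := by rw [hρi', mul_one]
    rw [Commute, SemiconjBy, ← mul_assoc, h4, mul_assoc, h3, smul_mul_assoc, mul_smul_comm,
      mul_assoc]
  have keya : ∀ k, Commute (fieldOp n (Sum.elim ((star U) k) (0 : Fin n → ℂ))) (ρi * D) :=
    fun k => key _ _ (boltzmann_mul (hamiltonian_mul_fieldOp_inl (vecMul_of_diagonalized hU hHU k)))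
      (gaussAverage_symbol_kms (sum_quadContr_inl (vecMul_of_diagonalized hU hLU k)) (hκ1 k))
  have keyc : ∀ k, Commute (fieldOp n (Sum.elim (0 : Fin n → ℂ) fun m => U m k)) (ρi * D) := by
    intro k
    refine key _ _ (boltzmann_mul (ε := -hH.eigenvalues k) ?_)
      (gaussAverage_symbol_kms (sum_quadContr_inr (mulVec_of_diagonalized hU hLU k)) (hκ2 k))
    rw [hamiltonian_mul_fieldOp_inr (mulVec_of_diagonalized hU hHU k), neg_smul, sub_neg_eq_add]
  -- Unitarity recovers the site operators from the eigenmodes.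
  have hann : ∀ l, ann l = ∑ k, U l k • fieldOp n (Sum.elim ((star U) k) (0 : Fin n → ℂ)) := by
    intro l
    simp only [fieldOp_sum_inl, Finset.smul_sum, smul_smul]
    rw [Finset.sum_comm]
    simp only [← Finset.sum_smul, ← Matrix.mul_apply, hU', Matrix.one_apply, ite_smul, one_smul,
      zero_smul]
    simp
  have hcre : ∀ l, cre l =
      ∑ k, (star U) k l • fieldOp n (Sum.elim (0 : Fin n → ℂ) fun m => U m k) := by
    intro l
    simp only [fieldOp_sum_inr, Finset.smul_sum, smul_smul]
    rw [Finset.sum_comm]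
    simp only [mul_comm ((star U) _ _), ← Finset.sum_smul, ← Matrix.mul_apply, hU',
      Matrix.one_apply, ite_smul, one_smul, zero_smul]
    simp
  obtain ⟨c, hc⟩ := exists_eq_smul_one_of_commute (C := ρi * D)
    (fun l => by
      rw [hann]; exact Commute.sum_left _ _ _ fun k _ => (keya k).smul_left _)
    (fun l => by
      rw [hcre]; exact Commute.sum_left _ _ _ fun k _ => (keyc k).smul_left _)
  refine ⟨c, fun X => ?_⟩
  have hDc : D = c • ρ := by
    rw [← one_mul D, ← hρi', mul_assoc, hc, mul_smul_comm, mul_one]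
  rw [hD, hDc, mul_smul_comm, Matrix.trace_smul, smul_eq_mul]

/-- The eigenvalues are `cosh / sinh`: `cosh` is positive, and `sinh` is nonzero since no eigenvalue
of `H` and not `β` vanishes. -/
lemma det_linkMatrix_ne_zero {H : Matrix (Fin n) (Fin n) ℂ} (hH : H.IsHermitian)
    (hgap : ∀ k, hH.eigenvalues k ≠ 0) {β : ℝ} (hβ : β ≠ 0) : (linkMatrix β H).det ≠ 0 := by
  have hU : IsUnit ((hH.eigenvectorUnitary : Matrix (Fin n) (Fin n) ℂ).det *
      (star (hH.eigenvectorUnitary : Matrix (Fin n) (Fin n) ℂ)).det) := by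
    have h1 : (hH.eigenvectorUnitary : Matrix (Fin n) (Fin n) ℂ) *
        star (hH.eigenvectorUnitary : Matrix (Fin n) (Fin n) ℂ) = 1 :=
      Unitary.coe_mul_star_self _
    rw [← Matrix.det_mul, h1, Matrix.det_one]
    exact isUnit_one
  rw [linkMatrix_eq hH, Matrix.det_mul, Matrix.det_mul, mul_right_comm, Matrix.det_diagonal]
  refine mul_ne_zero hU.ne_zero (Finset.prod_ne_zero_iff.2 fun k _ => ?_)
  have h2 : Real.sinh (β / 2 * hH.eigenvalues k) ≠ 0 :=
    Real.sinh_ne_zero.2 (mul_ne_zero (div_ne_zero hβ two_ne_zero) (hgap k))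
  exact_mod_cast div_ne_zero (Real.cosh_pos _).ne' h2

/-! ### Two-point functions -/

lemma gaussAverage_thetaBar_mul_theta {h : Matrix (Fin n) (Fin n) ℂ} (hdet : h.det ≠ 0)
    (j l : Fin n) :
    gaussAverage h (thetaBar j * theta l) = -(gaussAverage h 1 * h⁻¹ l j) := by
  have h1 : ∀ l m, ∑ i, gaussAverage h (thetaBar i * theta l) * h i m =
      -(if l = m then gaussAverage h 1 else 0) := by
    intro l m
    -- Integration by parts of `∂θ_l/∂θ_m`. Over all `l`, `m` this is the matrix equation `G h =
    -- -gaussAverage h 1 • 1` with `G l i` the average of `θ̄_i θ_l`, which explains the transposed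
    -- index order of `h⁻¹`.
    have := gaussAverage_contr h (LinearMap.proj (Sum.inl m)) (theta l)
    have e1 : contr (LinearMap.proj (Sum.inl m)) (theta l : Grassmann n) =
        (if l = m then 1 else 0 : ℂ) • 1 := by
      rw [← mul_one (theta l), contr_theta_mul]
      simp [contr, Pi.single_apply, eq_comm]
    have e2 : ∀ i, quadContr (LinearMap.proj (Sum.inl m)) i (h i) = -(h i m • thetaBar i) := by
      intro i
      simp [quadContr, thetaIncl]
    rw [e1, Finset.sum_mul, map_sum] at this
    simp only [e2, neg_mul, smul_mul_assoc, map_neg, map_smul, Finset.sum_neg_distrib,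
      smul_eq_mul] at this
    simp only [mul_comm _ (h _ _)]
    rw [← neg_eq_iff_eq_neg, ← this]
    split_ifs <;> simp
  have h2 : (Matrix.of fun l i => gaussAverage h (thetaBar i * theta l)) * h =
      -(gaussAverage h 1 • (1 : Matrix (Fin n) (Fin n) ℂ)) := by
    ext l m
    rw [Matrix.mul_apply]
    simp only [Matrix.of_apply, h1, Matrix.neg_apply, Matrix.smul_apply, Matrix.one_apply,
      smul_eq_mul, mul_ite, mul_one, mul_zero]
  have h3 := congrArg (· * h⁻¹) h2
  simp only [Matrix.mul_nonsing_inv_cancel_right _ _ (isUnit_iff_ne_zero.2 hdet), neg_mul,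
    smul_mul_assoc, one_mul] at h3
  exact congrFun (congrFun h3 l) j

lemma symbol_cre_mul_ann (j l : Fin n) : symbol n (cre j * ann l) =
    (1 / 2 : ℂ) • (thetaBar j * theta l + if j = l then 1 else 0) := by
  have h := symbol_fieldOp_mul (Pi.single (Sum.inl l) 1) (1 : FockOp n)
  rw [fieldOp_single_inl, mul_one, symbol_one, leftAct_inl] at h
  rw [← fieldOp_single_inr, symbol_fieldOp_mul, h, leftAct_inr, map_smul, mul_smul_comm,
    ← smul_add, smul_smul, invSqrtTwo_mul_self]
  congr 1
  have e1 : contr (LinearMap.proj (Sum.inr l)) (1 : Grassmann n) = 0 := by simp [contr]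
  have e2 : contr (LinearMap.proj (Sum.inl j)) (1 : Grassmann n) = 0 := by simp [contr]
  rw [e1, add_zero, contr_theta_mul, e2, mul_one]
  simp [Pi.single_apply]

end Thermal

end FreeFermion

end

/-! ### Normalization and assembly. -/

theorem mainTheorem2 (n : ℕ) (H : Matrix (Fin n) (Fin n) ℂ) (hH : H.IsHermitian)
    (hgap : ∀ k, hH.eigenvalues k ≠ 0) (β : ℝ) (hβ : β ≠ 0) :
    (∃! Φ : FreeFermion.FockOp n →ₗ[ℂ] FreeFermion.Grassmann n,
      FreeFermion.IsGrassmannMapping Φ) ∧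
    FreeFermion.partitionFunction β H ≠ 0 ∧
    FreeFermion.berezin (FreeFermion.gaussWeight (FreeFermion.linkMatrix β H)) =
      (-FreeFermion.linkMatrix β H).det ∧
    (-FreeFermion.linkMatrix β H).det ≠ 0 ∧
    (∀ Φ : FreeFermion.FockOp n →ₗ[ℂ] FreeFermion.Grassmann n,
      FreeFermion.IsGrassmannMapping Φ → ∀ X : FreeFermion.FockOp n,
        FreeFermion.thermalAverage β H X =
          (FreeFermion.berezin (FreeFermion.gaussWeight (FreeFermion.linkMatrix β H)))⁻¹ *
            FreeFermion.berezin
              (Φ X * FreeFermion.gaussWeight (FreeFermion.linkMatrix β H))) ∧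
    (∀ j l : Fin n,
      FreeFermion.thermalAverage β H (FreeFermion.cre j * FreeFermion.ann l) =
        (1 / 2 : ℂ) * ((if j = l then 1 else 0) - (FreeFermion.linkMatrix β H)⁻¹ l j)) ∧
    (∀ j l : Fin n,
      (FreeFermion.berezin (FreeFermion.gaussWeight (FreeFermion.linkMatrix β H)))⁻¹ *
          FreeFermion.berezin (FreeFermion.thetaBar j * FreeFermion.theta l *
            FreeFermion.gaussWeight (FreeFermion.linkMatrix β H)) =
        -(FreeFermion.linkMatrix β H)⁻¹ l j) := by
  open FreeFermion in
  have hdet := det_linkMatrix_ne_zero hH hgap hβ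
  have hdet' : (-linkMatrix β H).det ≠ 0 := by
    rw [Matrix.det_neg]
    exact mul_ne_zero (pow_ne_zero _ (by norm_num)) hdet
  have hber := berezin_gaussWeight (linkMatrix β H)
  have hne : berezin (gaussWeight (linkMatrix β H)) ≠ 0 := hber ▸ hdet'
  have hone : gaussAverage (linkMatrix β H) 1 = berezin (gaussWeight (linkMatrix β H)) := by
    rw [gaussAverage_apply, one_mul]
  obtain ⟨c, hc⟩ := exists_gaussAverage_symbol_eq hH hgap hβ
  -- Taking `X = 1` fixes the constant; as the left side is nonzero, so are both `c` and `Z`.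
  have hcZ : berezin (gaussWeight (linkMatrix β H)) = c * partitionFunction β H := by
    rw [← hone, ← symbol_one, hc, one_mul, partitionFunction]
  have hcne : c ≠ 0 := left_ne_zero_of_mul (hcZ ▸ hne)
  have hZ : partitionFunction β H ≠ 0 := right_ne_zero_of_mul (hcZ ▸ hne)
  have havg : ∀ X, thermalAverage β H X = (berezin (gaussWeight (linkMatrix β H)))⁻¹ *
      gaussAverage (linkMatrix β H) (symbol n X) := by
    intro X
    rw [hc, hcZ, thermalAverage]
    field_simp
  have htwo : ∀ j l, (berezin (gaussWeight (linkMatrix β H)))⁻¹ *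
      gaussAverage (linkMatrix β H) (thetaBar j * theta l) = -(linkMatrix β H)⁻¹ l j := by
    intro j l
    rw [gaussAverage_thetaBar_mul_theta hdet, hone, mul_neg, inv_mul_cancel_left₀ hne]
  refine ⟨⟨symbol n, isGrassmannMapping_symbol, fun Φ hΦ => hΦ.eq_symbol⟩, hZ, hber, hdet', ?_,
    ?_, ?_⟩
  · intro Φ hΦ X
    rw [havg, hΦ.eq_symbol, gaussAverage_apply]
  · intro j l
    rw [havg, symbol_cre_mul_ann, map_smul, map_add, smul_eq_mul, mul_left_comm, mul_add, htwo]
    split_ifs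
    · rw [hone, inv_mul_cancel₀ hne]; ring
    · rw [map_zero]; ring
  · intro j l
    rw [← htwo, gaussAverage_apply]
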